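/- **Setting.** An explicit $s$-stage two-derivative method is $$y^{(i)}=u^n+\Delta t\sum_{j<i}\bigl(a_{ij}F(y^{(j)})+\Delta t\,\hat a_{ij}\dot F(y^{(j)})\bigr),\qquad u^{n+1}=u^n+\Delta t\sum_{j=1}^{s}\bigl(b_jF(y^{(j)})+\Delta t\,\hat b_j\dot F(y^{(j)})\bigr).$$ It has *order $p$* if, for every smooth autonomous system $u'=F(u)$ on $\mathbb R^d$ and with $\dot F=F_uF$, the local error of one step is $O(\Delta t^{p+1})$. Put $S=\begin{pmatrix}A&0\\ b^T&0\end{pmatrix}$, $\hat S=\begin{pmatrix}\hat A&0\\ \hat b^T&0\end{pmatrix}$ and, for $K,r>0$, $$R=\Bigl(I+rS+\tfrac{r^2}{K^2}\hat S\Bigr)^{-1},\quad P=rRS,\quad Q=\tfrac{r^2}{K^2}R\hat S .$$ The *SSP conditions at $r$* (for the given $K$) are $Re\ge0$, $P\ge0$, $Q\ge0$ componentwise, where $e=(1,\dots,1)^T$; the *SSP coefficient* $\mathcal C$ is the largest $r>0$ at which they hold. A method *preserves strong stability for $\Delta t\le r\Delta t_{FE}$* if for every convex functional $\|\cdot\|$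 on a real vector space and all $F,\dot F$ with $\|u+\Delta t F(u)\|\le\|u\|$ for all $u$ and $0\le\Delta t\le\Delta t_{FE}$, and $\|u+\Delta t^2\dot F(u)\|\le\|u\|$ for all $u$ and $0\le\Delta t\le K\Delta t_{FE}$ (where $\Delta t_{FE}>0$), one has $\|u^{n+1}\|\le\|u^n\|$ whenever $0\le\Delta t\le r\Delta t_{FE}$. Consider the three-stage methods $$\begin{aligned}u^*&=u^n+a_{21}\Delta tF(u^n)+\hat a_{21}\Delta t^2\dot F(u^n),\\ u^{**}&=u^n+a_{31}\Delta tF(u^n)+\hat a_{31}\Delta t^2\dot F(u^n)+\hat a_{32}\Delta t^2\dot F(u^*),\\ u^{n+1}&=u^n+\Delta tF(u^n)+\Delta t^2\bigl(\hat b_1\dot F(u^n)+\hat b_2\dot F(u^*)+\hat b_3\dot F(u^{**})\bigr).\end{aligned}\tag{$*$}$$ **Theorem.** 1. A method of the form $(*)$ has order five if and only if $a_{21}\notin\{0,\tfrac12,\tfrac35\}$ and $$\hat a_{21}=\tfrac12a_{21}^2,\quad a_{31}=\frac{\frac35-a_{21}}{1-2a_{21}},\quad \hat a_{32}=\tfrac1{10}\Bigl(\frac{(\frac35-a_{21})^2}{a_{21}(1-2a_{21})^3}-\frac{\frac35-a_{21}}{(1-2a_{21})^2}\Bigr),\quad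 \hat a_{31}=\tfrac12\frac{(\frac35-a_{21})^2}{(1-2a_{21})^2}-\hat a_{32},$$ $$\hat b_2=\frac{2a_{31}-1}{12a_{21}(a_{31}-a_{21})},\quad \hat b_3=\frac{1-2a_{21}}{12a_{31}(a_{31}-a_{21})},\quad \hat b_1=\tfrac12-\hat b_2-\hat b_3 .$$ Equivalently, the coefficients satisfy the algebraic order conditions (with $c=Ae$, $\hat c=\hat Ae$, componentwise products): $b^Te=1$; $b^Tc+\hat b^Te=\frac12$; $b^Tc^2+2\hat b^Tc=\frac13$; $b^TAc+b^T\hat c+\hat b^Tc=\frac16$; $b^Tc^3+3\hat b^Tc^2=\frac14$; $b^TcAc+b^Tc\hat c+\hat b^Tc^2+\hat b^TAc+\hat b^T\hat c=\frac18$; $b^TAc^2+2b^T\hat Ac+\hat b^Tc^2=\frac1{12}$; $b^TA^2c+b^TA\hat c+b^T\hat Ac+\hat b^TAc+\hat b^T\hat c=\frac1{24}$; $b^Tc^4+4\hat b^Tc^3=\frac15$; $b^Tc^2Ac+b^Tc^2\hat c+\hat b^Tc^3+2\hat b^TcAc+2\hat b^Tc\hat c=\frac1{10}$; $b^TcAc^2+2b^Tc\hat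 Ac+\hat b^Tc^3+\hat b^TAc^2+2\hat b^T\hat Ac=\frac1{15}$; $b^TcA^2c+b^TcA\hat c+b^Tc\hat Ac+\hat b^TcAc+\hat b^Tc\hat c+\hat b^TA^2c+\hat b^TA\hat c+\hat b^T\hat Ac=\frac1{30}$; $b^T(Ac)(Ac)+2b^T\hat cAc+b^T\hat c^2+2\hat b^TcAc+2\hat b^Tc\hat c=\frac1{20}$; $b^TAc^3+3b^T\hat Ac^2+\hat b^Tc^3=\frac1{20}$; $b^TA(cAc)+b^TA(c\hat c)+b^T\hat Ac^2+b^T\hat AAc+b^T\hat A\hat c+\hat b^TcAc+\hat b^Tc\hat c=\frac1{40}$; $b^TA^2c^2+2b^TA\hat Ac+b^T\hat Ac^2+\hat b^TAc^2+2\hat b^T\hat Ac=\frac1{60}$; $b^TA^3c+b^TA^2\hat c+b^TA\hat Ac+b^T\hat AAc+b^T\hat A\hat c+\hat b^TA^2c+\hat b^TA\hat c+\hat b^T\hat Ac=\frac1{120}$. 2. Let $K,r>0$. For the member of this family with parameter $a_{21}$ (where $a_{21}\notin\{0,\frac12,\frac35\}$), the last component of $Re$ vanishes if and only if $$a_{21}=a_{21}(K,r):=\frac{K^6}{r^6}\Bigl(-\frac2{K^4}r^5+\frac{10}{K^4}r^4+\frac{40}{K^2}r^3-\frac{120}{K^2}r^2-240r+240\Bigr),$$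 and $Q_{31}=0$ if and only if $q(K,r,a_{21})=0$, where $$q(K,r,a)=10r^2a^4-(100K^2+10r^2)a^3+(130K^2+3r^2)a^2-50K^2a+6K^2 .$$ 3. For every $K>0$ the equation $q(K,r,a_{21}(K,r))=0$ has a largest positive root $r=\mathcal C$. The value $a_{21}(K,\mathcal C)$ is not in $\{0,\frac12,\frac35\}$, and the member of the family with $a_{21}=a_{21}(K,\mathcal C)$ has order five, has last component of $Re$ and entry $Q_{31}$ equal to zero at $r=\mathcal C$, has SSP coefficient exactly $\mathcal C>0$, and preserves strong stability for $\Delta t\le\mathcal C\,\Delta t_{FE}$. Moreover $\mathcal C$ is the largest $r>0$ for which some member of the family has vanishing last component of $Re$ and satisfies the SSP conditions at $r$. 4. For $K=1/\sqrt2$ one has $|\mathcal C-0.6747|<5\cdot10^{-5}$. 5. This breaks the order barrier for explicit SSP Runge--Kutta methods: an explicit Runge--Kutta method with any number of stages (that is, $\hat A=0$, $\hat b=0$) that satisfies the SSP conditions for some $r>0$ has order at most four. -/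

import Mathlib

open Matrix Set Filter Topology Asymptotics
open scoped ContDiff

universe v

/-- An explicit `s`-stage two-derivative method, given by its Butcher coefficients
`A`, `Â` (strictly lower triangular) and `b`, `b̂`. -/
structure TwoDerivMethod (s : ℕ) where
  A : Matrix (Fin s) (Fin s) ℝ
  Ahat : Matrix (Fin s) (Fin s) ℝ
  b : Fin s → ℝ
  bhat : Fin s → ℝ
  A_explicit : ∀ i j, i ≤ j → A i j = 0
  Ahat_explicit : ∀ i j, i ≤ j → Ahat i j = 0

namespace TwoDerivMethod

variable {s : ℕ}

/-- The stages `y⁽ⁱ⁾ = u + h ∑_{j<i} (a_ij F(y⁽ʲ⁾) + h â_ij G(y⁽ʲ⁾))`, where `G` stands for the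
(possibly approximate) second time derivative. -/
noncomputable def stage {E : Type*} [AddCommGroup E] [Module ℝ E] (M : TwoDerivMethod s)
    (F G : E → E) (h : ℝ) (u : E) (i : Fin s) : E :=
  u + h • ∑ j : {j : Fin s // j < i},
    (M.A i j • F (stage M F G h u j) + h • M.Ahat i j • G (stage M F G h u j))
termination_by i
decreasing_by all_goals exact j.2

/-- One step `u ↦ u + h ∑_j (b_j F(y⁽ʲ⁾) + h b̂_j G(y⁽ʲ⁾))` of the method with step size `h`. -/
noncomputable def step {E : Type*} [AddCommGroup E] [Module ℝ E] (M : TwoDerivMethod s)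
    (F G : E → E) (h : ℝ) (u : E) : E :=
  u + h • ∑ j : Fin s,
    (M.b j • F (M.stage F G h u j) + h • M.bhat j • G (M.stage F G h u j))

/-- The method has order (at least) `p`: for every smooth autonomous system `u' = F(u)`, with the
exact second derivative `Ḟ = F_u F`, the local error of one step is `O(h^(p+1))`. -/
def HasOrder (M : TwoDerivMethod s) (p : ℕ) : Prop :=
  ∀ (d : ℕ) (F : EuclideanSpace ℝ (Fin d) → EuclideanSpace ℝ (Fin d)), ContDiff ℝ ∞ F →
    ∀ u : ℝ → EuclideanSpace ℝ (Fin d), (∀ᶠ t in 𝓝 0, HasDerivAt u (F (u t)) t) →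
      (fun h : ℝ => M.step F (fun v => fderiv ℝ F v (F v)) h (u 0) - u h)
        =O[𝓝[>] 0] fun h : ℝ => h ^ (p + 1)

/-- The abscissae `c = A e`. -/
def c (M : TwoDerivMethod s) : Fin s → ℝ := M.A *ᵥ 1

/-- The vector `ĉ = Â e`. -/
def chat (M : TwoDerivMethod s) : Fin s → ℝ := M.Ahat *ᵥ 1

/-- The algebraic conditions for order five of a multistage two-derivative method; products and
powers of vectors are componentwise. -/
def OrderConditionsFive (M : TwoDerivMethod s) : Prop :=
  -- order 1
  M.b ⬝ᵥ 1 = 1 ∧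
  -- order 2
  M.b ⬝ᵥ M.c + M.bhat ⬝ᵥ 1 = 1 / 2 ∧
  -- order 3
  M.b ⬝ᵥ M.c ^ 2 + 2 * (M.bhat ⬝ᵥ M.c) = 1 / 3 ∧
  M.b ⬝ᵥ M.A *ᵥ M.c + M.b ⬝ᵥ M.chat + M.bhat ⬝ᵥ M.c = 1 / 6 ∧
  -- order 4
  M.b ⬝ᵥ M.c ^ 3 + 3 * (M.bhat ⬝ᵥ M.c ^ 2) = 1 / 4 ∧
  M.b ⬝ᵥ (M.c * M.A *ᵥ M.c) + M.b ⬝ᵥ (M.c * M.chat) + M.bhat ⬝ᵥ M.c ^ 2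
    + M.bhat ⬝ᵥ M.A *ᵥ M.c + M.bhat ⬝ᵥ M.chat = 1 / 8 ∧
  M.b ⬝ᵥ M.A *ᵥ (M.c ^ 2) + 2 * (M.b ⬝ᵥ M.Ahat *ᵥ M.c) + M.bhat ⬝ᵥ M.c ^ 2 = 1 / 12 ∧
  M.b ⬝ᵥ M.A *ᵥ M.A *ᵥ M.c + M.b ⬝ᵥ M.A *ᵥ M.chat + M.b ⬝ᵥ M.Ahat *ᵥ M.c
    + M.bhat ⬝ᵥ M.A *ᵥ M.c + M.bhat ⬝ᵥ M.chat = 1 / 24 ∧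
  -- order 5
  M.b ⬝ᵥ M.c ^ 4 + 4 * (M.bhat ⬝ᵥ M.c ^ 3) = 1 / 5 ∧
  M.b ⬝ᵥ (M.c ^ 2 * M.A *ᵥ M.c) + M.b ⬝ᵥ (M.c ^ 2 * M.chat) + M.bhat ⬝ᵥ M.c ^ 3
    + 2 * (M.bhat ⬝ᵥ (M.c * M.A *ᵥ M.c)) + 2 * (M.bhat ⬝ᵥ (M.c * M.chat)) = 1 / 10 ∧
  M.b ⬝ᵥ (M.c * M.A *ᵥ (M.c ^ 2)) + 2 * (M.b ⬝ᵥ (M.c * M.Ahat *ᵥ M.c)) + M.bhat ⬝ᵥ M.c ^ 3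
    + M.bhat ⬝ᵥ M.A *ᵥ (M.c ^ 2) + 2 * (M.bhat ⬝ᵥ M.Ahat *ᵥ M.c) = 1 / 15 ∧
  M.b ⬝ᵥ (M.c * M.A *ᵥ M.A *ᵥ M.c) + M.b ⬝ᵥ (M.c * M.A *ᵥ M.chat)
    + M.b ⬝ᵥ (M.c * M.Ahat *ᵥ M.c) + M.bhat ⬝ᵥ (M.c * M.A *ᵥ M.c)
    + M.bhat ⬝ᵥ (M.c * M.chat) + M.bhat ⬝ᵥ M.A *ᵥ M.A *ᵥ M.c
    + M.bhat ⬝ᵥ M.A *ᵥ M.chat + M.bhat ⬝ᵥ M.Ahat *ᵥ M.c = 1 / 30 ∧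
  M.b ⬝ᵥ (M.A *ᵥ M.c) ^ 2 + 2 * (M.b ⬝ᵥ (M.chat * M.A *ᵥ M.c)) + M.b ⬝ᵥ M.chat ^ 2
    + 2 * (M.bhat ⬝ᵥ (M.c * M.A *ᵥ M.c)) + 2 * (M.bhat ⬝ᵥ (M.c * M.chat)) = 1 / 20 ∧
  M.b ⬝ᵥ M.A *ᵥ (M.c ^ 3) + 3 * (M.b ⬝ᵥ M.Ahat *ᵥ (M.c ^ 2)) + M.bhat ⬝ᵥ M.c ^ 3 = 1 / 20 ∧
  M.b ⬝ᵥ M.A *ᵥ (M.c * M.A *ᵥ M.c) + M.b ⬝ᵥ M.A *ᵥ (M.c * M.chat)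
    + M.b ⬝ᵥ M.Ahat *ᵥ (M.c ^ 2) + M.b ⬝ᵥ M.Ahat *ᵥ M.A *ᵥ M.c
    + M.b ⬝ᵥ M.Ahat *ᵥ M.chat + M.bhat ⬝ᵥ (M.c * M.A *ᵥ M.c)
    + M.bhat ⬝ᵥ (M.c * M.chat) = 1 / 40 ∧
  M.b ⬝ᵥ M.A *ᵥ M.A *ᵥ (M.c ^ 2) + 2 * (M.b ⬝ᵥ M.A *ᵥ M.Ahat *ᵥ M.c)
    + M.b ⬝ᵥ M.Ahat *ᵥ (M.c ^ 2) + M.bhat ⬝ᵥ M.A *ᵥ (M.c ^ 2)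
    + 2 * (M.bhat ⬝ᵥ M.Ahat *ᵥ M.c) = 1 / 60 ∧
  M.b ⬝ᵥ M.A *ᵥ M.A *ᵥ M.A *ᵥ M.c + M.b ⬝ᵥ M.A *ᵥ M.A *ᵥ M.chat
    + M.b ⬝ᵥ M.A *ᵥ M.Ahat *ᵥ M.c + M.b ⬝ᵥ M.Ahat *ᵥ M.A *ᵥ M.c
    + M.b ⬝ᵥ M.Ahat *ᵥ M.chat + M.bhat ⬝ᵥ M.A *ᵥ M.A *ᵥ M.c
    + M.bhat ⬝ᵥ M.A *ᵥ M.chat + M.bhat ⬝ᵥ M.Ahat *ᵥ M.c = 1 / 120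

/-- The bordered matrix `S = [A 0; bᵀ 0]`. The index `Sum.inr ()` is the last one, that of the
value `uⁿ⁺¹`. -/
def S (M : TwoDerivMethod s) : Matrix (Fin s ⊕ Unit) (Fin s ⊕ Unit) ℝ :=
  Matrix.fromBlocks M.A 0 (Matrix.of fun _ j => M.b j) 0

/-- The bordered matrix `Ŝ = [Â 0; b̂ᵀ 0]`. -/
def Shat (M : TwoDerivMethod s) : Matrix (Fin s ⊕ Unit) (Fin s ⊕ Unit) ℝ :=
  Matrix.fromBlocks M.Ahat 0 (Matrix.of fun _ j => M.bhat j) 0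

/-- `R = (I + r S + (r²/K²) Ŝ)⁻¹`; the matrix inverted is unipotent lower triangular. -/
noncomputable def R (M : TwoDerivMethod s) (K r : ℝ) :
    Matrix (Fin s ⊕ Unit) (Fin s ⊕ Unit) ℝ :=
  (1 + r • M.S + (r ^ 2 / K ^ 2) • M.Shat)⁻¹

/-- The vector `R e`. -/
noncomputable def Re (M : TwoDerivMethod s) (K r : ℝ) : Fin s ⊕ Unit → ℝ := M.R K r *ᵥ 1

/-- `P = r R S`. -/
noncomputable def P (M : TwoDerivMethod s) (K r : ℝ) :
    Matrix (Fin s ⊕ Unit) (Fin s ⊕ Unit) ℝ := r • (M.R K r * M.S)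

/-- `Q = (r²/K²) R Ŝ`. -/
noncomputable def Q (M : TwoDerivMethod s) (K r : ℝ) :
    Matrix (Fin s ⊕ Unit) (Fin s ⊕ Unit) ℝ := (r ^ 2 / K ^ 2) • (M.R K r * M.Shat)

/-- The SSP conditions at `r`: `R e`, `P` and `Q` are componentwise nonnegative. -/
def SSPConditions (M : TwoDerivMethod s) (K r : ℝ) : Prop :=
  (∀ i, 0 ≤ M.Re K r i) ∧ (∀ i j, 0 ≤ M.P K r i j) ∧ (∀ i j, 0 ≤ M.Q K r i j)

/-- The method has SSP coefficient `C > 0`: the largest `r > 0` at which the SSP conditions hold. -/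
def IsSSPCoefficient (M : TwoDerivMethod s) (K C : ℝ) : Prop :=
  IsGreatest {r : ℝ | 0 < r ∧ M.SSPConditions K r} C

/-- The method preserves strong stability for `Δt ≤ r Δt_FE`: for every convex functional `φ`, and
all `F`, `G` that satisfy the forward Euler condition for `Δt ≤ τ = Δt_FE` and the second
derivative condition for `Δt ≤ K τ`, every step with `Δt ≤ r τ` does not increase `φ`. -/
def PreservesStrongStability (M : TwoDerivMethod s) (K r : ℝ) : Prop :=
  ∀ (E : Type v) [AddCommGroup E] [Module ℝ E] (φ : E → ℝ) (F G : E → E) (τ : ℝ),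
    ConvexOn ℝ univ φ → 0 < τ →
    (∀ (u : E) (h : ℝ), 0 ≤ h → h ≤ τ → φ (u + h • F u) ≤ φ u) →
    (∀ (u : E) (h : ℝ), 0 ≤ h → h ≤ K * τ → φ (u + h ^ 2 • G u) ≤ φ u) →
    ∀ (u : E) (h : ℝ), 0 ≤ h → h ≤ r * τ → φ (M.step F G h u) ≤ φ u

/-- Explicit Runge--Kutta methods are the methods that do not use the second derivative. -/
def IsRungeKutta (M : TwoDerivMethod s) : Prop := M.Ahat = 0 ∧ M.bhat = 0

end TwoDerivMethod

/-- The simplified three-stage method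
`u*   = u + a₂₁ h F(u) + â₂₁ h² Ḟ(u)`,
`u**  = u + a₃₁ h F(u) + â₃₁ h² Ḟ(u) + â₃₂ h² Ḟ(u*)`,
`uⁿ⁺¹ = u + h F(u) + h² (b̂₁ Ḟ(u) + b̂₂ Ḟ(u*) + b̂₃ Ḟ(u**))`. -/
def simplifiedMethod (a21 a31 ah21 ah31 ah32 bh1 bh2 bh3 : ℝ) : TwoDerivMethod 3 where
  A := !![0, 0, 0; a21, 0, 0; a31, 0, 0]
  Ahat := !![0, 0, 0; ah21, 0, 0; ah31, ah32, 0]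
  b := ![1, 0, 0]
  bhat := ![bh1, bh2, bh3]
  A_explicit := by
    intro i j h
    fin_cases i <;> fin_cases j <;> simp at h ⊢
  Ahat_explicit := by
    intro i j h
    fin_cases i <;> fin_cases j <;> simp at h ⊢

namespace FifthOrder

/-- The values of `a₂₁` at which no denominator in the formulas below vanishes
(`a₃₁ = a₂₁` never happens). -/
def Admissible (a : ℝ) : Prop := a ≠ 0 ∧ a ≠ 1 / 2 ∧ a ≠ 3 / 5

noncomputable def a31 (a : ℝ) : ℝ := (3 / 5 - a) / (1 - 2 * a)

noncomputable def ah21 (a : ℝ) : ℝ := 1 / 2 * a ^ 2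

noncomputable def ah32 (a : ℝ) : ℝ :=
  1 / 10 * ((3 / 5 - a) ^ 2 / (a * (1 - 2 * a) ^ 3) - (3 / 5 - a) / (1 - 2 * a) ^ 2)

noncomputable def ah31 (a : ℝ) : ℝ := 1 / 2 * ((3 / 5 - a) ^ 2 / (1 - 2 * a) ^ 2) - ah32 a

noncomputable def bh2 (a : ℝ) : ℝ := (2 * a31 a - 1) / (12 * a * (a31 a - a))

noncomputable def bh3 (a : ℝ) : ℝ := (1 - 2 * a) / (12 * a31 a * (a31 a - a))

noncomputable def bh1 (a : ℝ) : ℝ := 1 / 2 - bh2 a - bh3 a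

/-- The one-parameter family, `a = a₂₁`. -/
noncomputable def family (a : ℝ) : TwoDerivMethod 3 :=
  simplifiedMethod a (a31 a) (ah21 a) (ah31 a) (ah32 a) (bh1 a) (bh2 a) (bh3 a)

/-- The value of `a₂₁` prescribed by `K` and `r`. -/
noncomputable def a21Of (K r : ℝ) : ℝ :=
  K ^ 6 / r ^ 6 * (-(2 / K ^ 4) * r ^ 5 + 10 / K ^ 4 * r ^ 4 + 40 / K ^ 2 * r ^ 3
    - 120 / K ^ 2 * r ^ 2 - 240 * r + 240)

/-- The polynomial in `a = a₂₁`, `r`, `K` whose vanishing expresses that the entry of `Q` in the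
row of the third stage and the column of the first stage is zero. -/
def qPoly (K r a : ℝ) : ℝ :=
  10 * r ^ 2 * a ^ 4 - (100 * K ^ 2 + 10 * r ^ 2) * a ^ 3 + (130 * K ^ 2 + 3 * r ^ 2) * a ^ 2
    - 50 * K ^ 2 * a + 6 * K ^ 2

/-- `C` is the largest positive root `r` of `qPoly K r a` with `a = a₂₁(K, r)`. -/
def IsLargestRoot (K C : ℝ) : Prop :=
  IsGreatest {r : ℝ | 0 < r ∧ qPoly K r (a21Of K r) = 0} C

end FifthOrder

/-! Strong stability: multiplying Y = u e + h S F(Y) + h² Ŝ G(Y) by `R` and using R + P + Q = I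
gives Y = (Re) u + P (Y + (h/r) F(Y)) + Q (Y + (K h/r)² G(Y)). Under the SSP conditions each stage
is a convex combination of `u` and of permitted steps from earlier stages, so induction applies
(`SSPConditions.preservesStrongStability`).

Order five: the conditions collapse to seven equations (`ReducedOrderConditions`). They are
necessary because the polynomial system `testField` has components whose local errors are single
monomials. They suffice because both inner stages are accurate to second order and their third-order
defects cancel in the update (`ReducedOrderConditions.local_error`). Solving them leaves only `a21`
free (`reducedOrderConditions_iff`).

SSP coefficient: with k = r²/K², the order conditions turn the vanishing of the last entry of Re
into r (1 - k/6 + k²/120) = 1 - k/2 + k²/24 - k³ a/240 (`eq_a21Of_iff`). The entry Q₃₁ is minus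
`qPoly` times a factor that the SSP conditions force to be positive, so these conditions imply
`qPoly` ≤ 0. Along a = `a21Of K r`, `qPoly` is negative wherever a = 81/100 and positive from r = 10
on. Hence a largest root exists and has a < 81/100; the two equations then confine a and k to two
small ranges (`range_of_root`), where the remaining SSP inequalities can be checked. Maximality
holds because `qPoly` is positive past the largest root and, for fixed a ≠ 0, increases with r.

Order barrier: for Runge–Kutta methods P ≥ 0 makes `S` nonnegative with transitive support. Order
five forces b_j (c_j²/2 - (Ac)_j)² = 0 for every j, so by induction c vanishes wherever b does not,
contradicting bᵀc = 1/2. -/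

namespace TwoDerivMethod

variable {s : ℕ}

/-! ### The stages and the new value as one system -/

section Stages

variable {E : Type*} [AddCommGroup E] [Module ℝ E]

/-- The defining equation of the stages, with the sum extended over all stages. -/
lemma stage_eq (M : TwoDerivMethod s) (F G : E → E) (h : ℝ) (u : E) (i : Fin s) :
    M.stage F G h u i = u + h • ∑ j : Fin s,
      (M.A i j • F (M.stage F G h u j) + h • M.Ahat i j • G (M.stage F G h u j)) := by
  rw [stage]
  congr 2
  refine (Finset.sum_subtype (p := fun j => j < i) (Finset.univ.filter fun j => j < i) (by simp)
    fun j => M.A i j • F (M.stage F G h u j)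
      + h • M.Ahat i j • G (M.stage F G h u j)).symm.trans ?_
  refine Finset.sum_subset (Finset.subset_univ _) fun j _ hj => ?_
  have hij : i ≤ j := by simpa using hj
  rw [M.A_explicit i j hij, M.Ahat_explicit i j hij, zero_smul, zero_smul, smul_zero, add_zero]

/-- The stages together with the new value, indexed as the bordered matrices. -/
noncomputable def extendedStage (M : TwoDerivMethod s) (F G : E → E) (h : ℝ) (u : E) :
    Fin s ⊕ Unit → E :=
  Sum.elim (M.stage F G h u) fun _ => M.step F G h u

/-- The zero last columns of `S` and `Shat` absorb the terms at the new value, so stages and step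
obey a single equation. -/
lemma extendedStage_eq (M : TwoDerivMethod s) (F G : E → E) (h : ℝ) (u : E) (i : Fin s ⊕ Unit) :
    M.extendedStage F G h u i = u + ∑ j,
      ((h * M.S i j) • F (M.extendedStage F G h u j)
        + (h ^ 2 * M.Shat i j) • G (M.extendedStage F G h u j)) := by
  rw [Fintype.sum_sum_type]
  rcases i with i | i
  · simp only [extendedStage, Sum.elim_inl, S, Shat, fromBlocks_apply₁₁, fromBlocks_apply₁₂,
      Matrix.zero_apply, mul_zero, zero_smul, add_zero, Finset.sum_const_zero]
    rw [stage_eq]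
    simp only [Finset.smul_sum, smul_add, smul_smul, pow_two, mul_assoc]
  · simp only [extendedStage, Sum.elim_inl, Sum.elim_inr, S, Shat, fromBlocks_apply₂₁,
      fromBlocks_apply₂₂, Matrix.of_apply,
      Matrix.zero_apply, mul_zero, zero_smul, add_zero, Finset.sum_const_zero]
    rw [step]
    simp only [Finset.smul_sum, smul_add, smul_smul, pow_two, mul_assoc]

end Stages

/-! ### Triangular structure and the convex-combination form -/

/-- The position of an index of the bordered matrices; the new value comes last. -/
def level : Fin s ⊕ Unit → ℕ := Sum.elim (fun i => (i : ℕ)) fun _ => s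

lemma S_eq_zero (M : TwoDerivMethod s) {i j : Fin s ⊕ Unit} (h : level i ≤ level j) :
    M.S i j = 0 := by
  rcases i with i | i <;> rcases j with j | j <;> simp [level, S] at h ⊢
  · exact M.A_explicit i j h
  · omega

lemma Shat_eq_zero (M : TwoDerivMethod s) {i j : Fin s ⊕ Unit} (h : level i ≤ level j) :
    M.Shat i j = 0 := by
  rcases i with i | i <;> rcases j with j | j <;> simp [level, Shat] at h ⊢
  · exact M.Ahat_explicit i j h
  · omega

lemma level_injective : Function.Injective (level (s := s)) := by
  rintro (i | i) (j | j) h <;> simp [level] at h ⊢ <;> omega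

/-- The matrix whose inverse is `R`. -/
noncomputable def T (M : TwoDerivMethod s) (K r : ℝ) :
    Matrix (Fin s ⊕ Unit) (Fin s ⊕ Unit) ℝ :=
  1 + r • M.S + (r ^ 2 / K ^ 2) • M.Shat

lemma T_blockTriangular (M : TwoDerivMethod s) (K r : ℝ) :
    (M.T K r).BlockTriangular fun i => OrderDual.toDual (level i) := by
  intro i j hij
  have hij : level i < level j := hij
  have hne : i ≠ j := by rintro rfl; exact lt_irrefl _ hij
  simp [T, M.S_eq_zero hij.le, M.Shat_eq_zero hij.le, hne]

lemma T_det (M : TwoDerivMethod s) (K r : ℝ) : (M.T K r).det = 1 := by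
  -- The determinant lemma for triangular matrices needs a linear order on the index type; it is
  -- transported along `level`.
  let _ : LinearOrder (Fin s ⊕ Unit) := LinearOrder.lift' level level_injective
  rw [Matrix.det_of_isLowerTriangular _ (M.T_blockTriangular K r)]
  exact Finset.prod_eq_one fun i _ => by
    simp [T, M.S_eq_zero (le_refl (level i)), M.Shat_eq_zero (le_refl (level i))]

lemma R_mul_T (M : TwoDerivMethod s) (K r : ℝ) : M.R K r * M.T K r = 1 :=
  Matrix.nonsing_inv_mul _ (by
    rw [show 1 + r • M.S + (r ^ 2 / K ^ 2) • M.Shat = M.T K r from rfl, T_det]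
    exact isUnit_one)

lemma T_mul_R (M : TwoDerivMethod s) (K r : ℝ) : M.T K r * M.R K r = 1 :=
  Matrix.mul_nonsing_inv _ (by rw [T_det]; exact isUnit_one)

lemma R_eq_zero (M : TwoDerivMethod s) (K r : ℝ) {i j : Fin s ⊕ Unit} (h : level i < level j) :
    M.R K r i j = 0 := by
  have : Invertible (M.T K r) := Matrix.invertibleOfIsUnitDet _ (by rw [T_det]; exact isUnit_one)
  exact Matrix.blockTriangular_inv_of_blockTriangular (M.T_blockTriangular K r) h

lemma R_mul_eq_zero (M : TwoDerivMethod s) (K r : ℝ) {X : Matrix (Fin s ⊕ Unit) (Fin s ⊕ Unit) ℝ}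
    (hX : ∀ i j, level i ≤ level j → X i j = 0) {i j : Fin s ⊕ Unit} (h : level i ≤ level j) :
    (M.R K r * X) i j = 0 := by
  rw [Matrix.mul_apply]
  refine Finset.sum_eq_zero fun l _ => ?_
  rcases lt_or_ge (level i) (level l) with hl | hl
  · rw [M.R_eq_zero K r hl, zero_mul]
  · rw [hX l j (hl.trans h), mul_zero]

lemma P_eq_zero (M : TwoDerivMethod s) (K r : ℝ) {i j : Fin s ⊕ Unit} (h : level i ≤ level j) :
    M.P K r i j = 0 := by
  rw [P, Matrix.smul_apply, M.R_mul_eq_zero K r (fun _ _ => M.S_eq_zero) h, smul_zero]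

lemma Q_eq_zero (M : TwoDerivMethod s) (K r : ℝ) {i j : Fin s ⊕ Unit} (h : level i ≤ level j) :
    M.Q K r i j = 0 := by
  rw [Q, Matrix.smul_apply, M.R_mul_eq_zero K r (fun _ _ => M.Shat_eq_zero) h, smul_zero]

/-- Applied to the vector of ones, this says that the weights in each row of the rewritten scheme
sum to one. -/
lemma R_add_P_add_Q (M : TwoDerivMethod s) (K r : ℝ) :
    M.R K r + M.P K r + M.Q K r = 1 := by
  rw [← M.R_mul_T K r, P, Q, T, Matrix.mul_add, Matrix.mul_add, Matrix.mul_one, Matrix.mul_smul,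
    Matrix.mul_smul]

/-- The stages in terms of forward Euler and second derivative steps. -/
lemma extendedStage_eq_convex {E : Type*} [AddCommGroup E] [Module ℝ E] (M : TwoDerivMethod s)
    (F G : E → E) {K r : ℝ} (hK : K ≠ 0) (hr : r ≠ 0) (h : ℝ) (u : E) (i : Fin s ⊕ Unit) :
    M.extendedStage F G h u i = M.Re K r i • u
      + ∑ j, M.P K r i j • (M.extendedStage F G h u j
          + (h / r) • F (M.extendedStage F G h u j))
      + ∑ j, M.Q K r i j • (M.extendedStage F G h u j
          + (K * (h / r)) ^ 2 • G (M.extendedStage F G h u j)) := by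
  set Y := M.extendedStage F G h u with hY
  have hu : ∀ l, u = Y l - ∑ j, ((h * M.S l j) • F (Y j) + (h ^ 2 * M.Shat l j) • G (Y j)) :=
    fun l => by rw [eq_sub_iff_add_eq]; exact (M.extendedStage_eq F G h u l).symm
  -- `u` is expressed through the equation of every stage `l`, and these expressions are combined
  -- with the weights `R i l`; the rescalings h = r · (h/r) and h² = (r²/K²)(K h/r)² then produce
  -- `P` and `Q`.
  have h1 : M.Re K r i • u = ∑ l, M.R K r i l • Y l
      - ∑ j, ((M.P K r i j * (h / r)) • F (Y j)
        + (M.Q K r i j * (K * (h / r)) ^ 2) • G (Y j)) := by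
    have : M.Re K r i • u = ∑ l, M.R K r i l • u := by
      rw [← Finset.sum_smul]; simp [Re, Matrix.mulVec, dotProduct]
    rw [this, Finset.sum_congr rfl fun l _ => congrArg (M.R K r i l • ·) (hu l)]
    simp only [smul_sub, Finset.sum_sub_distrib, Finset.smul_sum, smul_add, smul_smul]
    congr 1
    rw [Finset.sum_comm]
    refine Finset.sum_congr rfl fun j _ => ?_
    rw [Finset.sum_add_distrib, ← Finset.sum_smul, ← Finset.sum_smul]
    congr 2
    · simp only [P, Matrix.smul_apply, Matrix.mul_apply, smul_eq_mul, Finset.mul_sum,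
        Finset.sum_mul]
      exact Finset.sum_congr rfl fun l _ => by field_simp
    · simp only [Q, Matrix.smul_apply, Matrix.mul_apply, smul_eq_mul, Finset.mul_sum,
        Finset.sum_mul]
      exact Finset.sum_congr rfl fun l _ => by field_simp
  have h2 : Y i = ∑ l, (M.R K r i l + M.P K r i l + M.Q K r i l) • Y l := by
    have : ∀ l, M.R K r i l + M.P K r i l + M.Q K r i l = (1 : Matrix _ _ ℝ) i l := fun l => by
      rw [← M.R_add_P_add_Q K r]; rfl
    simp [this, Matrix.one_apply]
  rw [h1]
  conv_lhs => rw [h2]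
  simp only [add_smul, Finset.sum_add_distrib, smul_add, smul_smul]
  abel

/-- The SSP conditions imply the preservation of strong stability. -/
theorem SSPConditions.preservesStrongStability {M : TwoDerivMethod s} {K r : ℝ} (hK : 0 < K)
    (hr : 0 < r) (hM : M.SSPConditions K r) : M.PreservesStrongStability.{v} K r := by
  intro E _ _ φ F G τ hφ hτ hF hG u h h0 hh
  obtain ⟨hRe, hP, hQ⟩ := hM
  have hhr : h / r ≤ τ := by rw [div_le_iff₀ hr]; linarith
  have hhr0 : 0 ≤ h / r := by positivity
  -- Strong induction on the level is possible because `P` and `Q` are strictly lower triangular.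
  have key : ∀ n : ℕ, ∀ i : Fin s ⊕ Unit, level i = n → φ (M.extendedStage F G h u i) ≤ φ u := by
    intro n
    induction n using Nat.strong_induction_on with
    | _ n ih =>
      rintro i rfl
      have hconv := hφ.convex_le (φ u)
      have hsum : M.Re K r i + (∑ j, M.P K r i j + ∑ j, M.Q K r i j) = 1 := by
        have : M.Re K r i + (∑ j, M.P K r i j + ∑ j, M.Q K r i j)
            = ((M.R K r + M.P K r + M.Q K r) *ᵥ 1) i := by
          simp [Re, Matrix.mulVec, dotProduct, Finset.sum_add_distrib, add_assoc]
        rw [this, M.R_add_P_add_Q]; simp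
      have hPn : ∀ j, M.P K r i j = 0 ∨ φ (M.extendedStage F G h u j) ≤ φ u := fun j => by
        rcases le_or_gt (level i) (level j) with hij | hij
        · exact Or.inl (M.P_eq_zero K r hij)
        · exact Or.inr (ih _ hij j rfl)
      have hQn : ∀ j, M.Q K r i j = 0 ∨ φ (M.extendedStage F G h u j) ≤ φ u := fun j => by
        rcases le_or_gt (level i) (level j) with hij | hij
        · exact Or.inl (M.Q_eq_zero K r hij)
        · exact Or.inr (ih _ hij j rfl)
      let w : Option ((Fin s ⊕ Unit) ⊕ (Fin s ⊕ Unit)) → ℝ :=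
        fun o => o.elim (M.Re K r i) (Sum.elim (M.P K r i) (M.Q K r i))
      -- Points of weight zero are replaced by `u`: they may involve later stages, on which no bound
      -- is available yet.
      let z : Option ((Fin s ⊕ Unit) ⊕ (Fin s ⊕ Unit)) → E :=
        fun o => o.elim u (Sum.elim
          (fun j => if M.P K r i j = 0 then u else M.extendedStage F G h u j
            + (h / r) • F (M.extendedStage F G h u j))
          (fun j => if M.Q K r i j = 0 then u else M.extendedStage F G h u j
            + (K * (h / r)) ^ 2 • G (M.extendedStage F G h u j)))
      have hmem : ∑ o, w o • z o ∈ {x | x ∈ (univ : Set E) ∧ φ x ≤ φ u} := by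
        refine hconv.sum_mem ?_ ?_ ?_
        · rintro (_ | j | j) _
          exacts [hRe i, hP i j, hQ i j]
        · rw [Fintype.sum_option, Fintype.sum_sum_type]; exact hsum
        · rintro (_ | j | j) _
          · exact ⟨mem_univ _, le_rfl⟩
          · refine ⟨mem_univ _, ?_⟩
            simp only [z, Option.elim, Sum.elim_inl]
            split_ifs with hz
            · exact le_rfl
            · exact (hF _ _ hhr0 hhr).trans ((hPn j).resolve_left hz)
          · refine ⟨mem_univ _, ?_⟩
            simp only [z, Option.elim, Sum.elim_inr]
            split_ifs with hz
            · exact le_rfl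
            · exact (hG _ _ (by positivity) (by gcongr)).trans ((hQn j).resolve_left hz)
      refine le_of_eq_of_le (congrArg φ ?_) hmem.2
      rw [M.extendedStage_eq_convex F G hK.ne' hr.ne' h u i, Fintype.sum_option,
        Fintype.sum_sum_type fun o => w (some o) • z (some o), add_assoc]
      refine congrArg₂ (· + ·) rfl (congrArg₂ (· + ·) (Finset.sum_congr rfl fun j _ => ?_)
        (Finset.sum_congr rfl fun j _ => ?_))
      · simp only [w, z, Option.elim, Sum.elim_inl]
        split_ifs with hz <;> simp [hz]
      · simp only [w, z, Option.elim, Sum.elim_inr]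
        split_ifs with hz <;> simp [hz]
  exact key _ (Sum.inr ()) rfl

/-! ### The order barrier: algebraic part -/

/-- For a Runge–Kutta method, `r S = (I - P)⁻¹ P`, written as a fixed-point equation. -/
lemma IsRungeKutta.S_eq {M : TwoDerivMethod s} (hM : M.IsRungeKutta) (K r : ℝ) :
    r • M.S = M.P K r + M.P K r * (r • M.S) := by
  have hS : M.Shat = 0 := by
    ext (i | i) (j | j) <;> simp [Shat, hM.1, hM.2]
  have hT : M.T K r = 1 + r • M.S := by simp [T, hS]
  have hP : M.P K r = M.R K r * (r • M.S) := by rw [P, Matrix.mul_smul]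
  have h1 := M.R_mul_T K r
  have hR : M.R K r = 1 - M.P K r := by
    rw [hT, Matrix.mul_add, Matrix.mul_one, ← hP] at h1
    exact eq_sub_of_add_eq h1
  conv_lhs => rw [← Matrix.one_mul (r • M.S)]
  rw [show (1 : Matrix (Fin s ⊕ Unit) (Fin s ⊕ Unit) ℝ) = M.R K r + M.P K r by rw [hR]; abel,
    Matrix.add_mul, ← hP]

/-- In rS = P + P(rS), row `i` on the right uses only rows of `S` of lower level, so nonnegativity
propagates. -/
lemma IsRungeKutta.S_nonneg {M : TwoDerivMethod s} (hM : M.IsRungeKutta) {K r : ℝ} (hr : 0 < r)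
    (hP : ∀ i j, 0 ≤ M.P K r i j) (i j : Fin s ⊕ Unit) : 0 ≤ M.S i j := by
  have key : ∀ n : ℕ, ∀ i : Fin s ⊕ Unit, level i = n → 0 ≤ (r • M.S) i j := by
    intro n
    induction n using Nat.strong_induction_on with
    | _ n ih =>
      rintro i rfl
      rw [(hM.S_eq K r), Matrix.add_apply, Matrix.mul_apply]
      refine add_nonneg (hP i j) (Finset.sum_nonneg fun l _ => ?_)
      rcases le_or_gt (level i) (level l) with hl | hl
      · rw [M.P_eq_zero K r hl, zero_mul]
      · exact mul_nonneg (hP i l) (ih _ hl l rfl)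
  have := key _ i rfl
  rw [Matrix.smul_apply, smul_eq_mul] at this
  exact nonneg_of_mul_nonneg_right this hr

/-- A positive entry (i, l) of rS = P + P(rS) comes either from P_il > 0 or from some m with P_im >
0 and S_ml > 0. In the second case m has lower level, so induction gives S_mj > 0. Either way a
positive term appears in r S_ij, and nothing cancels it. -/
lemma IsRungeKutta.S_trans {M : TwoDerivMethod s} (hM : M.IsRungeKutta) {K r : ℝ} (hr : 0 < r)
    (hP : ∀ i j, 0 ≤ M.P K r i j) {i l j : Fin s ⊕ Unit} (hil : 0 < M.S i l)
    (hlj : 0 < M.S l j) : 0 < M.S i j := by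
  have hS := hM.S_nonneg hr hP
  have key : ∀ n : ℕ, ∀ i : Fin s ⊕ Unit, level i = n → 0 < M.S i l → 0 < M.S i j := by
    intro n
    induction n using Nat.strong_induction_on with
    | _ n ih =>
      rintro i rfl hil
      have e1 := congrFun (congrFun (hM.S_eq K r) i) l
      have e2 := congrFun (congrFun (hM.S_eq K r) i) j
      simp only [Matrix.add_apply, Matrix.mul_apply, Matrix.smul_apply, smul_eq_mul] at e1 e2
      obtain ⟨m, hm1, hm2⟩ : ∃ m, 0 < M.P K r i m ∧ 0 < M.S m j := by
        rcases (hP i l).lt_or_eq with h | h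
        · exact ⟨l, h, hlj⟩
        · rw [← h, zero_add] at e1
          obtain ⟨m, -, hm⟩ := Finset.exists_ne_zero_of_sum_ne_zero
            (e1 ▸ (mul_pos hr hil).ne' : ∑ m, M.P K r i m * (r * M.S m l) ≠ 0)
          have hm1 : M.P K r i m ≠ 0 := fun h => hm (by rw [h, zero_mul])
          have hm2 : M.S m l ≠ 0 := fun h => hm (by rw [h, mul_zero, mul_zero])
          refine ⟨m, (hP i m).lt_of_ne' hm1, ih _ ?_ m rfl ((hS m l).lt_of_ne' hm2)⟩
          by_contra hlt
          exact hm1 (M.P_eq_zero K r (not_lt.1 hlt))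
      have : 0 < r * M.S i j := by
        rw [e2]
        refine add_pos_of_nonneg_of_pos (hP i j) (Finset.sum_pos' (fun m _ => ?_) ⟨m, Finset.mem_univ _, ?_⟩)
        · exact mul_nonneg (hP i m) (mul_nonneg hr.le (hS m j))
        · exact mul_pos hm1 (mul_pos hr hm2)
      exact pos_of_mul_pos_right this hr.le
  exact key _ i rfl hil

/-- The algebraic core of the order barrier. -/
lemma IsRungeKutta.false_of_order_conditions {M : TwoDerivMethod s} (hM : M.IsRungeKutta)
    {K r : ℝ} (hr : 0 < r) (hMr : M.SSPConditions K r)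
    (h2 : ∑ j, M.b j * M.c j = 1 / 2)
    (h5 : ∑ j, M.b j * (M.c j ^ 2 / 2 - (M.A *ᵥ M.c) j) ^ 2 = 0) : False := by
  have hS := hM.S_nonneg hr hMr.2.1
  have hb : ∀ j, 0 ≤ M.b j := fun j => by simpa [S] using hS (Sum.inr ()) (Sum.inl j)
  have hA : ∀ i j, 0 ≤ M.A i j := fun i j => by simpa [S] using hS (Sum.inl i) (Sum.inl j)
  have htr : ∀ i j, 0 < M.b i → 0 < M.A i j → 0 < M.b j := fun i j hi hij => by
    simpa [S] using hM.S_trans hr hMr.2.1 (i := Sum.inr ()) (l := Sum.inl i) (j := Sum.inl j)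
      (by simpa [S] using hi) (by simpa [S] using hij)
  have hz : ∀ j, M.b j * (M.c j ^ 2 / 2 - (M.A *ᵥ M.c) j) ^ 2 = 0 := fun j =>
    (Finset.sum_eq_zero_iff_of_nonneg fun j _ => mul_nonneg (hb j) (sq_nonneg _)).1 h5 j
      (Finset.mem_univ j)
  -- If b_i > 0, every j with a_ij > 0 has b_j > 0 by transitivity, hence c_j = 0 by induction. Thus
  -- (Ac)_i = 0, and the squared condition leaves c_i = 0.
  have key : ∀ n : ℕ, ∀ i : Fin s, (i : ℕ) = n → 0 < M.b i → M.c i = 0 := by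
    intro n
    induction n using Nat.strong_induction_on with
    | _ n ih =>
      rintro i rfl hi
      have h0 : (M.A *ᵥ M.c) i = 0 := by
        rw [Matrix.mulVec, dotProduct]
        refine Finset.sum_eq_zero fun j _ => ?_
        rcases (hA i j).lt_or_eq with h | h
        · have hji : j < i := by
            by_contra hle
            exact h.ne' (M.A_explicit i j (not_lt.1 hle))
          rw [ih j hji j rfl (htr i j hi h), mul_zero]
        · rw [← h, zero_mul]
      have := (mul_eq_zero.1 (hz i)).resolve_left hi.ne'
      rw [h0, sub_zero] at this
      simpa using this
  have : ∑ j, M.b j * M.c j = 0 := Finset.sum_eq_zero fun j _ => by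
    rcases (hb j).lt_or_eq with h | h
    · rw [key _ j rfl h, mul_zero]
    · rw [← h, zero_mul]
  rw [this] at h2
  norm_num at h2

end TwoDerivMethod

/-! ### Test problems that extract order conditions -/

namespace TwoDerivMethod

variable {s : ℕ}

/-- A component of the local error that is a monomial of degree at most `p` vanishes. -/
lemma HasOrder.coeff_eq_zero {M : TwoDerivMethod s} {p m : ℕ} (hM : M.HasOrder p) (hm : m ≤ p)
    {d : ℕ} {F : EuclideanSpace ℝ (Fin d) → EuclideanSpace ℝ (Fin d)} (hF : ContDiff ℝ ∞ F)
    {u : ℝ → EuclideanSpace ℝ (Fin d)} (hu : ∀ t, HasDerivAt u (F (u t)) t) (i : Fin d) (α : ℝ)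
    (hα : ∀ h, M.step F (fun v => fderiv ℝ F v (F v)) h (u 0) i - u h i = α * h ^ m) :
    α = 0 := by
  have h1 := hM d F hF u (Eventually.of_forall hu)
  have h2 : (fun h : ℝ => α * h ^ m) =O[𝓝[>] 0] fun h : ℝ => h ^ (p + 1) := by
    refine (IsBigO.of_bound 1 (Eventually.of_forall fun h => ?_)).trans h1
    rw [← hα, one_mul]
    exact PiLp.norm_apply_le (M.step F (fun v => fderiv ℝ F v (F v)) h (u 0) - u h) i
  have h3 : (fun h : ℝ => h ^ (p + 1)) =o[𝓝[>] 0] fun h : ℝ => h ^ m :=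
    (isLittleO_pow_pow (Nat.lt_succ_of_le hm)).mono nhdsWithin_le_nhds
  by_contra hne
  have h4 := (isLittleO_const_mul_left_iff hne).1 (h2.trans_isLittleO h3)
  refine isLittleO_irrefl ?_ h4
  refine Eventually.frequently (eventually_mem_nhdsWithin.mono fun h hh => ?_)
  exact pow_ne_zero _ (ne_of_gt hh)

lemma hasDerivAt_euclideanSpace {d : ℕ} {u : ℝ → EuclideanSpace ℝ (Fin d)}
    {u' : EuclideanSpace ℝ (Fin d)} {t : ℝ} (h : ∀ i, HasDerivAt (fun t => u t i) (u' i) t) :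
    HasDerivAt u u' t := by
  rw [hasDerivAt_iff_hasFDerivAt, ← hasFDerivWithinAt_univ, hasFDerivWithinAt_euclidean]
  intro i
  rw [hasFDerivWithinAt_univ]
  refine (h i).hasFDerivAt.congr_fderiv ?_
  ext
  simp

/-- The derivative of a vector field along itself, computed by components along a line. -/
lemma fderiv_apply_eq {d : ℕ} {F : EuclideanSpace ℝ (Fin d) → EuclideanSpace ℝ (Fin d)}
    (hF : ContDiff ℝ ∞ F) (v w w' : EuclideanSpace ℝ (Fin d))
    (h : ∀ i, HasDerivAt (fun t : ℝ => F (v + t • w) i) (w' i) 0) : fderiv ℝ F v w = w' := by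
  have h1 : HasDerivAt (fun t : ℝ => F (v + t • w)) w' 0 := hasDerivAt_euclideanSpace h
  have h2 : HasDerivAt (fun t : ℝ => v + t • w) w 0 := by
    simpa using ((hasDerivAt_id (0 : ℝ)).smul_const w).const_add v
  have h3 : HasFDerivAt F (fderiv ℝ F v) (v + (0 : ℝ) • w) := by
    rw [zero_smul, add_zero]
    exact (hF.differentiable (by simp)).differentiableAt.hasFDerivAt
  exact (h3.comp_hasDerivAt 0 h2).unique h1

/-- A quadrature problem that detects a stage order below two. -/
noncomputable def stageOrderField (v : EuclideanSpace ℝ (Fin 3)) : EuclideanSpace ℝ (Fin 3) :=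
  !₂[1, v 0, (v 0 ^ 2 / 2 - v 1) ^ 2]

lemma contDiff_stageOrderField : ContDiff ℝ ∞ stageOrderField := by
  rw [contDiff_euclidean]
  intro i
  fin_cases i <;> simp [stageOrderField] <;> fun_prop

/-- From zero initial data the exact third component is 0 while the method returns h⁵ times the
quadratic sum; the second component has error h² (bᵀc - 1/2). -/
lemma IsRungeKutta.order_conditions {M : TwoDerivMethod s} (hM : M.IsRungeKutta) {p : ℕ}
    (hp : 5 ≤ p) (h : M.HasOrder p) :
    ∑ j, M.b j * M.c j = 1 / 2 ∧
      ∑ j, M.b j * (M.c j ^ 2 / 2 - (M.A *ᵥ M.c) j) ^ 2 = 0 := by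
  set G := fun v => fderiv ℝ stageOrderField v (stageOrderField v) with hG
  let u : ℝ → EuclideanSpace ℝ (Fin 3) := fun t => !₂[t, t ^ 2 / 2, 0]
  have hu : ∀ t, HasDerivAt u (stageOrderField (u t)) t := by
    intro t
    refine hasDerivAt_euclideanSpace fun i => ?_
    fin_cases i
    · simpa [u, stageOrderField] using hasDerivAt_id' t
    · simpa [u, stageOrderField] using ((hasDerivAt_id' t).fun_pow 2).div_const 2
    · simpa [u, stageOrderField] using hasDerivAt_const t (0 : ℝ)
  have hu0 : ∀ i, u 0 i = 0 := fun i => by fin_cases i <;> simp [u]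
  have hst : ∀ k h j, M.stage stageOrderField G h (u 0) j k
      = h * ∑ l, M.A j l * stageOrderField (M.stage stageOrderField G h (u 0) l) k := by
    intro k h j
    rw [stage_eq]
    simp [hM.1, hu0]
  have hs0 : ∀ h j, M.stage stageOrderField G h (u 0) j 0 = h * M.c j := by
    intro h j
    rw [hst]
    simp [stageOrderField, c, Matrix.mulVec, dotProduct]
  have hs1 : ∀ h j, M.stage stageOrderField G h (u 0) j 1 = h ^ 2 * (M.A *ᵥ M.c) j := by
    intro h j
    rw [hst]
    simp only [stageOrderField, Matrix.mulVec, dotProduct, Finset.mul_sum]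
    refine Finset.sum_congr rfl fun l _ => ?_
    simp [hs0]
    ring
  have hstep : ∀ k h, M.step stageOrderField G h (u 0) k
      = h * ∑ l, M.b l * stageOrderField (M.stage stageOrderField G h (u 0) l) k := by
    intro k h
    rw [step]
    simp [hM.2, hu0]
  constructor
  · have := h.coeff_eq_zero (m := 2) (by omega) contDiff_stageOrderField hu 1
      (∑ j, M.b j * M.c j - 1 / 2) fun h => by
        rw [hstep]
        simp only [sub_mul, Finset.sum_mul, Finset.mul_sum]
        congr 1
        · refine Finset.sum_congr rfl fun l _ => ?_
          simp [stageOrderField, hs0]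
          ring
        · simp [u]
          ring
    linarith
  · refine h.coeff_eq_zero (m := 5) hp contDiff_stageOrderField hu 2 _ fun h => ?_
    rw [hstep]
    have hu2 : u h 2 = 0 := by simp [u]
    have hf : ∀ v, stageOrderField v 2 = (v 0 ^ 2 / 2 - v 1) ^ 2 := fun v => by
      simp [stageOrderField]
    rw [hu2, sub_zero, Finset.sum_mul, Finset.mul_sum]
    refine Finset.sum_congr rfl fun l _ => ?_
    rw [hf, hs0, hs1]
    ring

/-- Explicit Runge–Kutta methods that satisfy the SSP conditions have order at most four. -/
theorem IsRungeKutta.order_le_four {M : TwoDerivMethod s} (hM : M.IsRungeKutta) {K r : ℝ}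
    (hr : 0 < r) (hMr : M.SSPConditions K r) {p : ℕ} (h : M.HasOrder p) : p ≤ 4 := by
  by_contra hp
  obtain ⟨h2, h5⟩ := hM.order_conditions (by omega) h
  exact hM.false_of_order_conditions hr hMr h2 h5

/-- A triangular polynomial system that separates the order conditions of simplified methods. -/
noncomputable def testField (v : EuclideanSpace ℝ (Fin 8)) : EuclideanSpace ℝ (Fin 8) :=
  !₂[1, v 0, v 0 ^ 2, v 0 ^ 3, v 0 ^ 4, v 0 * v 1, v 0 ^ 2 * v 1, v 0 * v 2]

lemma contDiff_testField : ContDiff ℝ ∞ testField := by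
  rw [contDiff_euclidean]
  intro i
  fin_cases i <;> simp [testField] <;> fun_prop

lemma fderiv_testField (v : EuclideanSpace ℝ (Fin 8)) :
    fderiv ℝ testField v (testField v) =
      !₂[0, 1, 2 * v 0, 3 * v 0 ^ 2, 4 * v 0 ^ 3, v 1 + v 0 ^ 2, 2 * v 0 * v 1 + v 0 ^ 3,
        v 2 + v 0 ^ 3] := by
  refine fderiv_apply_eq contDiff_testField _ _ _ fun i => ?_
  have h0 : HasDerivAt (fun t : ℝ => v 0 + t * 1) 1 0 := by
    simpa using ((hasDerivAt_id (0 : ℝ)).mul_const (1 : ℝ)).const_add (v 0)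
  have h1 : HasDerivAt (fun t : ℝ => v 1 + t * v 0) (v 0) 0 := by
    simpa using ((hasDerivAt_id (0 : ℝ)).mul_const (v 0)).const_add (v 1)
  have h2 : HasDerivAt (fun t : ℝ => v 2 + t * v 0 ^ 2) (v 0 ^ 2) 0 := by
    simpa using ((hasDerivAt_id (0 : ℝ)).mul_const (v 0 ^ 2)).const_add (v 2)
  fin_cases i
  · simpa [testField] using hasDerivAt_const (0 : ℝ) (1 : ℝ)
  · simpa [testField] using h0
  · simpa [testField] using h0.fun_pow 2
  · simpa [testField] using h0.fun_pow 3
  · simpa [testField] using h0.fun_pow 4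
  · have := h0.fun_mul h1
    simp [testField] at this ⊢
    exact this.congr_deriv (by ring)
  · have := (h0.fun_pow 2).fun_mul h1
    simp [testField] at this ⊢
    exact this.congr_deriv (by ring)
  · have := h0.fun_mul h2
    simp [testField] at this ⊢
    exact this.congr_deriv (by ring)

end TwoDerivMethod

/-! ### Order conditions of the simplified form and their solution -/

section Simplified

variable {a21 a31 ah21 ah31 ah32 bh1 bh2 bh3 : ℝ}

lemma simplifiedMethod_stage_zero {E : Type*} [AddCommGroup E] [Module ℝ E] (F G : E → E) (h : ℝ)
    (u : E) : (simplifiedMethod a21 a31 ah21 ah31 ah32 bh1 bh2 bh3).stage F G h u 0 = u := by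
  rw [TwoDerivMethod.stage_eq, Fin.sum_univ_three]
  simp [simplifiedMethod]

lemma simplifiedMethod_stage_one {E : Type*} [AddCommGroup E] [Module ℝ E] (F G : E → E) (h : ℝ)
    (u : E) : (simplifiedMethod a21 a31 ah21 ah31 ah32 bh1 bh2 bh3).stage F G h u 1
      = u + (a21 * h) • F u + (ah21 * h ^ 2) • G u := by
  rw [TwoDerivMethod.stage_eq, Fin.sum_univ_three, simplifiedMethod_stage_zero]
  simp [simplifiedMethod]
  module

lemma simplifiedMethod_stage_two {E : Type*} [AddCommGroup E] [Module ℝ E] (F G : E → E) (h : ℝ)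
    (u : E) : (simplifiedMethod a21 a31 ah21 ah31 ah32 bh1 bh2 bh3).stage F G h u 2
      = u + (a31 * h) • F u + (ah31 * h ^ 2) • G u + (ah32 * h ^ 2) •
        G ((simplifiedMethod a21 a31 ah21 ah31 ah32 bh1 bh2 bh3).stage F G h u 1) := by
  rw [TwoDerivMethod.stage_eq, Fin.sum_univ_three, simplifiedMethod_stage_zero]
  simp [simplifiedMethod]
  module

lemma simplifiedMethod_step {E : Type*} [AddCommGroup E] [Module ℝ E] (F G : E → E) (h : ℝ)
    (u : E) : (simplifiedMethod a21 a31 ah21 ah31 ah32 bh1 bh2 bh3).step F G h u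
      = u + h • F u + h ^ 2 • (bh1 • G u
        + bh2 • G ((simplifiedMethod a21 a31 ah21 ah31 ah32 bh1 bh2 bh3).stage F G h u 1)
        + bh3 • G ((simplifiedMethod a21 a31 ah21 ah31 ah32 bh1 bh2 bh3).stage F G h u 2)) := by
  rw [TwoDerivMethod.step, Fin.sum_univ_three, simplifiedMethod_stage_zero]
  simp [simplifiedMethod]
  module

/-- The independent order conditions of a simplified method. -/
structure ReducedOrderConditions (a21 a31 ah21 ah31 ah32 bh1 bh2 bh3 : ℝ) : Prop where
  moment_zero : bh1 + bh2 + bh3 = 1 / 2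
  moment_one : bh2 * a21 + bh3 * a31 = 1 / 6
  moment_two : bh2 * a21 ^ 2 + bh3 * a31 ^ 2 = 1 / 12
  moment_three : bh2 * a21 ^ 3 + bh3 * a31 ^ 3 = 1 / 20
  stage_zero : bh2 * ah21 + bh3 * (ah31 + ah32) = 1 / 24
  stage_one : bh2 * (a21 * ah21) + bh3 * (a31 * (ah31 + ah32)) = 1 / 40
  nested : bh3 * (ah32 * a21) = 1 / 120

/-- `A` and `b` see only the first component, and `c` and `chat` vanish there. So Ac = 0 and the
pairings of `b` with stage quantities drop out, which makes most of the seventeen conditions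
redundant. -/
lemma orderConditionsFive_iff_reduced :
    (simplifiedMethod a21 a31 ah21 ah31 ah32 bh1 bh2 bh3).OrderConditionsFive ↔
      ReducedOrderConditions a21 a31 ah21 ah31 ah32 bh1 bh2 bh3 := by
  set M := simplifiedMethod a21 a31 ah21 ah31 ah32 bh1 bh2 bh3 with hM
  have hA : ∀ v, M.A *ᵥ v = ![0, a21 * v 0, a31 * v 0] := fun v => by
    ext i; fin_cases i <;> simp [hM, simplifiedMethod, Matrix.mulVec, dotProduct, Fin.sum_univ_three]
  have hAh : ∀ v, M.Ahat *ᵥ v = ![0, ah21 * v 0, ah31 * v 0 + ah32 * v 1] := fun v => by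
    ext i; fin_cases i <;> simp [hM, simplifiedMethod, Matrix.mulVec, dotProduct, Fin.sum_univ_three]
  have hb : ∀ v, M.b ⬝ᵥ v = v 0 := fun v => by
    simp [hM, simplifiedMethod, dotProduct, Fin.sum_univ_three]
  have hbh : ∀ v, M.bhat ⬝ᵥ v = bh1 * v 0 + bh2 * v 1 + bh3 * v 2 := fun v => by
    simp [hM, simplifiedMethod, dotProduct, Fin.sum_univ_three]
  simp only [TwoDerivMethod.OrderConditionsFive, TwoDerivMethod.c, TwoDerivMethod.chat, hA, hAh,
    hb, hbh, Pi.mul_apply, Pi.pow_apply, Pi.one_apply, Matrix.cons_val_zero, Matrix.cons_val_one,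
    Matrix.cons_val]
  constructor
  · rintro ⟨-, h2, h3, -, h5, h6, -, -, h9, h10, h11, -⟩
    constructor <;> linarith
  · rintro ⟨h1, h2, h3, h4, h5, h6, h7⟩
    refine ⟨?_, ?_, ?_, ?_, ?_, ?_, ?_, ?_, ?_, ?_, ?_, ?_, ?_, ?_, ?_, ?_, ?_⟩ <;> first | trivial | linarith

/-- The polynomial `2 a² - 2 a + 3/5`, which has no real zeros. -/
noncomputable def nodeQuadratic (a : ℝ) : ℝ := 2 * a ^ 2 - 2 * a + 3 / 5

lemma nodeQuadratic_pos (a : ℝ) : 0 < nodeQuadratic a := by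
  unfold nodeQuadratic
  nlinarith [sq_nonneg (2 * a - 1)]

namespace FifthOrder

lemma Admissible.one_sub_ne {a : ℝ} (h : Admissible a) : 1 - 2 * a ≠ 0 := fun h' =>
  h.2.1 (by linarith)

lemma Admissible.sub_ne {a : ℝ} (h : Admissible a) : 3 / 5 - a ≠ 0 := fun h' =>
  h.2.2 (by linarith)

lemma Admissible.one_sub_ne' {a : ℝ} (h : Admissible a) : 1 - a * 2 ≠ 0 := fun h' =>
  h.2.1 (by linarith)

lemma Admissible.sub_ne' {a : ℝ} (h : Admissible a) : 3 - a * 5 ≠ 0 := fun h' =>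
  h.2.2 (by linarith)

lemma Admissible.a31_sub {a : ℝ} (h : Admissible a) :
    FifthOrder.a31 a - a = nodeQuadratic a / (1 - 2 * a) := by
  have := h.one_sub_ne
  have := h.one_sub_ne'
  rw [FifthOrder.a31, nodeQuadratic]
  field_simp
  ring

lemma Admissible.bh2_eq {a : ℝ} (h : Admissible a) :
    FifthOrder.bh2 a = 1 / (60 * a * nodeQuadratic a) := by
  have := h.one_sub_ne
  have := h.one_sub_ne'
  have := h.1
  have := (nodeQuadratic_pos a).ne'
  rw [FifthOrder.bh2, h.a31_sub, FifthOrder.a31]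
  field_simp
  ring

lemma Admissible.bh3_eq {a : ℝ} (h : Admissible a) :
    FifthOrder.bh3 a = (1 - 2 * a) ^ 3 / (12 * (3 / 5 - a) * nodeQuadratic a) := by
  have := h.one_sub_ne
  have := h.one_sub_ne'
  have := h.sub_ne
  have := h.sub_ne'
  have := (nodeQuadratic_pos a).ne'
  rw [FifthOrder.bh3, h.a31_sub, FifthOrder.a31]
  field_simp

lemma Admissible.ah32_eq {a : ℝ} (h : Admissible a) :
    FifthOrder.ah32 a = (3 / 5 - a) * nodeQuadratic a / (10 * a * (1 - 2 * a) ^ 3) := by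
  have := h.one_sub_ne
  have := h.one_sub_ne'
  have := h.1
  rw [FifthOrder.ah32, nodeQuadratic]
  field_simp
  ring

lemma Admissible.ah31_add {a : ℝ} :
    FifthOrder.ah31 a + FifthOrder.ah32 a = 1 / 2 * FifthOrder.a31 a ^ 2 := by
  rw [FifthOrder.ah31, FifthOrder.a31, div_pow]
  ring

lemma Admissible.reducedOrderConditions {a : ℝ} (h : Admissible a) :
    ReducedOrderConditions a (FifthOrder.a31 a) (FifthOrder.ah21 a) (FifthOrder.ah31 a)
      (FifthOrder.ah32 a) (FifthOrder.bh1 a) (FifthOrder.bh2 a) (FifthOrder.bh3 a) := by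
  have h1 := h.one_sub_ne
  have := h.one_sub_ne'
  have h2 := h.sub_ne
  have := h.sub_ne'
  have h3 := h.1
  have h4 := (nodeQuadratic_pos a).ne'
  have m1 : FifthOrder.bh2 a * a + FifthOrder.bh3 a * FifthOrder.a31 a = 1 / 6 := by
    rw [h.bh2_eq, h.bh3_eq, FifthOrder.a31]
    field_simp
    rw [nodeQuadratic]
    ring
  have m2 : FifthOrder.bh2 a * a ^ 2 + FifthOrder.bh3 a * FifthOrder.a31 a ^ 2 = 1 / 12 := by
    rw [h.bh2_eq, h.bh3_eq, FifthOrder.a31]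
    field_simp
    rw [nodeQuadratic]
    ring
  have m3 : FifthOrder.bh2 a * a ^ 3 + FifthOrder.bh3 a * FifthOrder.a31 a ^ 3 = 1 / 20 := by
    rw [h.bh2_eq, h.bh3_eq, FifthOrder.a31]
    field_simp
    rw [nodeQuadratic]
    ring
  refine ⟨?_, m1, m2, m3, ?_, ?_, ?_⟩
  · rw [FifthOrder.bh1]; ring
  · rw [Admissible.ah31_add, FifthOrder.ah21]; linarith
  · rw [Admissible.ah31_add, FifthOrder.ah21]; linarith
  · rw [h.bh3_eq, h.ah32_eq]
    field_simp
    norm_num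

end FifthOrder

-- The moment equations determine the nodes and weights, the two stage equations force second-order
-- accuracy of the inner stages, and `nested` then fixes `ah32`.
open FifthOrder in
lemma reducedOrderConditions_iff :
    ReducedOrderConditions a21 a31 ah21 ah31 ah32 bh1 bh2 bh3 ↔
      Admissible a21 ∧ ah21 = FifthOrder.ah21 a21 ∧ a31 = FifthOrder.a31 a21 ∧
        ah32 = FifthOrder.ah32 a21 ∧ ah31 = FifthOrder.ah31 a21 ∧
        bh2 = FifthOrder.bh2 a21 ∧ bh3 = FifthOrder.bh3 a21 ∧ bh1 = FifthOrder.bh1 a21 := by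
  constructor
  · rintro ⟨m0, m1, m2, m3, s0, s1, n⟩
    -- The moments are applied to c (c - a₂₁)(c - a₃₁), which vanishes at both nodes; this relation
    -- is linear in `a31`.
    have hnode : (3 / 5 - a21) = a31 * (1 - 2 * a21) := by
      linear_combination -12 * (m3 - (a21 + a31) * m2 + a21 * a31 * m1)
    have ha0 : a21 ≠ 0 := by rintro rfl; norm_num at n
    have ha1 : a21 ≠ 1 / 2 := by rintro rfl; norm_num at hnode
    have hb0 : a31 ≠ 0 := by
      rintro rfl
      have : a21 = 1 / 2 := by linear_combination 6 * m2 - 6 * a21 * m1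
      exact ha1 this
    have h1 : 1 - 2 * a21 ≠ 0 := fun h => ha1 (by linarith)
    have ha2 : a21 ≠ 3 / 5 := by
      rintro rfl
      rw [sub_self] at hnode
      exact mul_ne_zero hb0 h1 hnode.symm
    have hadm : Admissible a21 := ⟨ha0, ha1, ha2⟩
    have hb : a31 = FifthOrder.a31 a21 := by rw [FifthOrder.a31, hnode, mul_div_cancel_right₀ _ h1]
    have hd : a31 - a21 ≠ 0 := by
      rw [hb, hadm.a31_sub]; exact div_ne_zero (nodeQuadratic_pos _).ne' h1
    have hbh3 : bh3 = FifthOrder.bh3 a21 := by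
      rw [FifthOrder.bh3, ← hb, eq_div_iff (by positivity)]
      linear_combination 12 * m2 - 12 * a21 * m1
    have hbh2 : bh2 = FifthOrder.bh2 a21 := by
      rw [FifthOrder.bh2, ← hb, eq_div_iff (by positivity)]
      linear_combination 12 * a31 * m1 - 12 * m2
    have hbh3' : bh3 ≠ 0 := by rintro rfl; norm_num at n
    have hbh2' : bh2 ≠ 0 := by
      rw [hbh2, hadm.bh2_eq]
      have := nodeQuadratic_pos a21
      positivity
    have hbh1 : bh1 = FifthOrder.bh1 a21 := by rw [FifthOrder.bh1, ← hbh2, ← hbh3]; linarith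
    -- With d = ĉ - c²/2, the moments reduce `s0` and `s1` to a homogeneous Vandermonde system for
    -- b̂₂d₂ and b̂₃d₃. The nodes are distinct and the weights nonzero, so both d vanish.
    have e2 : ah21 = 1 / 2 * a21 ^ 2 := by
      have : bh2 * (a31 - a21) * (ah21 - 1 / 2 * a21 ^ 2) = 0 := by
        linear_combination a31 * s0 - s1 - a31 / 2 * m2 + m3 / 2
      exact sub_eq_zero.1 ((mul_eq_zero.1 this).resolve_left (mul_ne_zero hbh2' hd))
    have e3 : ah31 + ah32 = 1 / 2 * a31 ^ 2 := by
      have : bh3 * (a31 - a21) * (ah31 + ah32 - 1 / 2 * a31 ^ 2) = 0 := by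
        linear_combination s1 - a21 * s0 - m3 / 2 + a21 / 2 * m2
      exact sub_eq_zero.1 ((mul_eq_zero.1 this).resolve_left (mul_ne_zero hbh3' hd))
    have hah32 : ah32 = FifthOrder.ah32 a21 := by
      have := hadm.reducedOrderConditions.nested
      rw [← hbh3] at this
      have h' : (bh3 * a21) * (ah32 - FifthOrder.ah32 a21) = 0 := by
        linear_combination n - this
      exact sub_eq_zero.1 ((mul_eq_zero.1 h').resolve_left (mul_ne_zero hbh3' ha0))
    refine ⟨hadm, e2, hb, hah32, ?_, hbh2, hbh3, hbh1⟩
    have := Admissible.ah31_add (a := a21)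
    rw [← hb, ← hah32] at this
    linarith
  · rintro ⟨h, rfl, rfl, rfl, rfl, rfl, rfl, rfl⟩
    exact h.reducedOrderConditions

-- With `testField` and zero initial data, components 1 to 7 of the local error are monomials in h
-- of degree at most five, so their coefficients vanish. Components 1 to 4 give the moments; the
-- last three, combined with these, give the stage and nested conditions.
open TwoDerivMethod in
lemma reducedOrderConditions_of_hasOrder
    (h : (simplifiedMethod a21 a31 ah21 ah31 ah32 bh1 bh2 bh3).HasOrder 5) :
    ReducedOrderConditions a21 a31 ah21 ah31 ah32 bh1 bh2 bh3 := by
  set M := simplifiedMethod a21 a31 ah21 ah31 ah32 bh1 bh2 bh3 with hMdef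
  let u : ℝ → EuclideanSpace ℝ (Fin 8) :=
    fun t => !₂[t, t ^ 2 / 2, t ^ 3 / 3, t ^ 4 / 4, t ^ 5 / 5, t ^ 4 / 8, t ^ 5 / 10, t ^ 5 / 15]
  have hd : ∀ (n : ℕ) (c d t : ℝ), d = n * t ^ (n - 1) / c →
      HasDerivAt (fun t : ℝ => t ^ n / c) d t := fun n c d t hd => by
    rw [hd]; exact (hasDerivAt_pow n t).div_const c
  have hu : ∀ t, HasDerivAt u (testField (u t)) t := by
    intro t
    refine hasDerivAt_euclideanSpace fun i => ?_
    fin_cases i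
    · simpa [u, testField] using hasDerivAt_id' t
    · exact hd 2 2 _ t (by simp [u, testField])
    · exact hd 3 3 _ t (by simp [u, testField])
    · exact hd 4 4 _ t (by simp [u, testField])
    · exact hd 5 5 _ t (by simp [u, testField])
    · exact hd 4 8 _ t (by simp [u, testField]; ring)
    · exact hd 5 10 _ t (by simp [u, testField]; ring)
    · exact hd 5 15 _ t (by simp [u, testField]; ring)
  have hu0 : u 0 = 0 := by
    ext i; fin_cases i <;> simp [u]
  set G := fun v => fderiv ℝ testField v (testField v) with hG
  have hF0 : testField 0 = !₂[1, 0, 0, 0, 0, 0, 0, 0] := by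
    ext i; fin_cases i <;> simp [testField]
  have hGv : ∀ v, G v = !₂[0, 1, 2 * v 0, 3 * v 0 ^ 2, 4 * v 0 ^ 3, v 1 + v 0 ^ 2,
      2 * v 0 * v 1 + v 0 ^ 3, v 2 + v 0 ^ 3] := fderiv_testField
  have h1 : ∀ h, M.stage testField G h (u 0) 1
      = !₂[a21 * h, ah21 * h ^ 2, 0, 0, 0, 0, 0, 0] := by
    intro h
    rw [hMdef, simplifiedMethod_stage_one, hu0, hF0, hGv]
    ext i; fin_cases i <;> simp
  have h2 : ∀ h, M.stage testField G h (u 0) 2 0 = a31 * h ∧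
      M.stage testField G h (u 0) 2 1 = (ah31 + ah32) * h ^ 2 ∧
      M.stage testField G h (u 0) 2 2 = 2 * ah32 * a21 * h ^ 3 := by
    intro h
    rw [hMdef, simplifiedMethod_stage_two, ← hMdef, h1, hu0, hF0, hGv, hGv]
    refine ⟨?_, ?_, ?_⟩ <;> simp <;> ring
  have hstep : ∀ k h, M.step testField G h (u 0) k
      = h * testField 0 k + h ^ 2 * (bh1 * G 0 k
        + bh2 * G (M.stage testField G h (u 0) 1) k
        + bh3 * G (M.stage testField G h (u 0) 2) k) := by
    intro k h
    rw [hMdef, simplifiedMethod_step, ← hMdef, hu0]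
    simp only [PiLp.add_apply, PiLp.smul_apply, smul_eq_mul, zero_add]
  have hG0 : G 0 = !₂[0, 1, 0, 0, 0, 0, 0, 0] := by
    rw [hGv]; ext i; fin_cases i <;> simp
  have hG1 : ∀ h, G (M.stage testField G h (u 0) 1) = !₂[0, 1, 2 * (a21 * h), 3 * (a21 * h) ^ 2,
      4 * (a21 * h) ^ 3, ah21 * h ^ 2 + (a21 * h) ^ 2,
      2 * (a21 * h) * (ah21 * h ^ 2) + (a21 * h) ^ 3, (a21 * h) ^ 3] := fun h => by
    rw [hGv, h1]; ext i; fin_cases i <;> simp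
  have hG2 : ∀ h, G (M.stage testField G h (u 0) 2) = !₂[0, 1, 2 * (a31 * h), 3 * (a31 * h) ^ 2,
      4 * (a31 * h) ^ 3, (ah31 + ah32) * h ^ 2 + (a31 * h) ^ 2,
      2 * (a31 * h) * ((ah31 + ah32) * h ^ 2) + (a31 * h) ^ 3,
      2 * ah32 * a21 * h ^ 3 + (a31 * h) ^ 3] := fun h => by
    rw [hGv, (h2 h).1, (h2 h).2.1, (h2 h).2.2]
  have hut : ∀ t, u t = !₂[t, t ^ 2 / 2, t ^ 3 / 3, t ^ 4 / 4, t ^ 5 / 5, t ^ 4 / 8, t ^ 5 / 10,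
      t ^ 5 / 15] := fun _ => rfl
  have key := fun (k : Fin 8) (m : ℕ) (hm : m ≤ 5) (α : ℝ) =>
    h.coeff_eq_zero hm contDiff_testField hu k α
  have e1 := key 1 2 (by norm_num) (bh1 + bh2 + bh3 - 1 / 2) fun h => by
    rw [hstep, hF0, hG0, hG1, hG2, hut h]; simp; ring
  have e2 := key 2 3 (by norm_num) (2 * (bh2 * a21 + bh3 * a31) - 1 / 3) fun h => by
    rw [hstep, hF0, hG0, hG1, hG2, hut h]; simp; ring
  have e3 := key 3 4 (by norm_num) (3 * (bh2 * a21 ^ 2 + bh3 * a31 ^ 2) - 1 / 4) fun h => by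
    rw [hstep, hF0, hG0, hG1, hG2, hut h]; simp; ring
  have e4 := key 4 5 (by norm_num) (4 * (bh2 * a21 ^ 3 + bh3 * a31 ^ 3) - 1 / 5) fun h => by
    rw [hstep, hF0, hG0, hG1, hG2, hut h]; simp; ring
  have e5 := key 5 4 (by norm_num) (bh2 * (ah21 + a21 ^ 2) + bh3 * ((ah31 + ah32) + a31 ^ 2)
      - 1 / 8) fun h => by
    rw [hstep, hF0, hG0, hG1, hG2, hut h]; simp; ring
  have e6 := key 6 5 (by norm_num) (bh2 * (2 * a21 * ah21 + a21 ^ 3)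
      + bh3 * (2 * a31 * (ah31 + ah32) + a31 ^ 3) - 1 / 10) fun h => by
    rw [hstep, hF0, hG0, hG1, hG2, hut h]; simp; ring
  have e7 := key 7 5 (by norm_num) (bh2 * a21 ^ 3
      + bh3 * (2 * ah32 * a21 + a31 ^ 3) - 1 / 15) fun h => by
    rw [hstep, hF0, hG0, hG1, hG2, hut h]; simp; ring
  constructor <;> linarith

end Simplified

/-! ### Taylor expansion of the local error -/

section LocalError

variable {E : Type*} [NormedAddCommGroup E] [NormedSpace ℝ E]

/-- Integration of an asymptotic bound at zero. -/
lemma isBigO_pow_succ_of_hasDerivAt {f f' : ℝ → E} {n : ℕ}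
    (hf : ∀ᶠ t in 𝓝 0, HasDerivAt f (f' t) t) (h0 : f 0 = 0)
    (hf' : f' =O[𝓝 0] fun t : ℝ => t ^ n) : f =O[𝓝 0] fun t : ℝ => t ^ (n + 1) := by
  obtain ⟨C, hC0, hC⟩ := hf'.exists_pos
  rw [isBigOWith_iff] at hC
  obtain ⟨ε, hε, hball⟩ := Metric.eventually_nhds_iff_ball.1 (hf.and hC)
  refine IsBigO.of_bound C ?_
  filter_upwards [Metric.ball_mem_nhds (0 : ℝ) hε] with t ht
  have hsub : Metric.closedBall (0 : ℝ) |t| ⊆ Metric.ball 0 ε :=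
    Metric.closedBall_subset_ball (by simpa using ht)
  have hmv := (convex_closedBall (0 : ℝ) |t|).norm_image_sub_le_of_norm_hasDerivWithin_le
    (f := f) (f' := f') (C := C * |t| ^ n) (x := 0) (y := t)
    (fun x hx => (hball x (hsub hx)).1.hasDerivWithinAt)
    (fun x hx => by
      have hx' : |x| ≤ |t| := by simpa using hx
      refine (hball x (hsub hx)).2.trans ?_
      rw [norm_pow, Real.norm_eq_abs]
      gcongr)
    (by simp) (by simp)
  rw [h0, sub_zero, sub_zero] at hmv
  rw [norm_pow, Real.norm_eq_abs, pow_succ]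
  rw [Real.norm_eq_abs] at hmv
  linarith

/-- Taylor's formula with a big-O remainder, for a chain of derivatives. -/
lemma taylor_isBigO {f : ℕ → ℝ → E}
    (hf : ∀ k, ∀ᶠ t in 𝓝 0, HasDerivAt (f k) (f (k + 1) t) t) (n k : ℕ) :
    (fun t => f k t - ∑ j ∈ Finset.range n, (t ^ j / j.factorial) • f (k + j) 0)
      =O[𝓝 0] fun t : ℝ => t ^ n := by
  induction n generalizing k with
  | zero =>
    simpa using (hf k).self_of_nhds.continuousAt.isBigO_one ℝ
  | succ n ih =>
    refine isBigO_pow_succ_of_hasDerivAt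
      (f' := fun t => f (k + 1) t - ∑ j ∈ Finset.range n, (t ^ j / j.factorial) • f (k + 1 + j) 0)
      ?_ ?_ (ih (k + 1))
    · filter_upwards [hf k] with t ht
      refine ht.sub ?_
      have : ∀ j ∈ Finset.range (n + 1), HasDerivAt
          (fun t : ℝ => (t ^ j / (j.factorial : ℝ)) • f (k + j) 0)
          (((j : ℝ) * t ^ (j - 1) / (j.factorial : ℝ)) • f (k + j) 0) t := fun j _ =>
        ((hasDerivAt_pow j t).div_const _).smul_const _
      refine (HasDerivAt.fun_sum this).congr_deriv ?_
      rw [Finset.sum_range_succ']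
      simp only [Nat.cast_zero, zero_mul, zero_div, zero_smul, add_zero]
      refine Finset.sum_congr rfl fun j _ => ?_
      rw [Nat.factorial_succ, add_tsub_cancel_right, show k + (j + 1) = k + 1 + j by ring]
      congr 1
      push_cast
      field_simp
    · rw [Finset.sum_range_succ']
      simp

/-- The `k`-th derivative of a solution of `u' = F u`, as a function of the state. -/
noncomputable def lieDerivative (F : E → E) : ℕ → E → E
  | 0 => id
  | k + 1 => fun v => fderiv ℝ (lieDerivative F k) v (F v)

lemma contDiff_lieDerivative {F : E → E} (hF : ContDiff ℝ ∞ F) (k : ℕ) :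
    ContDiff ℝ ∞ (lieDerivative F k) := by
  induction k with
  | zero => exact contDiff_id
  | succ k ih => exact (ih.fderiv_right (m := ∞) (by simp)).clm_apply hF

lemma lieDerivative_one (F : E → E) : lieDerivative F 1 = F := by
  ext v
  simp [lieDerivative]

lemma lieDerivative_two (F : E → E) : lieDerivative F 2 = fun v => fderiv ℝ F v (F v) := by
  ext v
  rw [lieDerivative, lieDerivative_one]

lemma hasDerivAt_lieDerivative {F : E → E} (hF : ContDiff ℝ ∞ F) {u : ℝ → E}
    (hu : ∀ᶠ t in 𝓝 0, HasDerivAt u (F (u t)) t) (k : ℕ) :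
    ∀ᶠ t in 𝓝 0, HasDerivAt (fun t => lieDerivative F k (u t)) (lieDerivative F (k + 1) (u t)) t := by
  filter_upwards [hu] with t ht
  exact (((contDiff_lieDerivative hF k).differentiable (by simp)).differentiableAt.hasFDerivAt
    (x := u t)).comp_hasDerivAt t ht

omit [NormedSpace ℝ E] in
lemma isBigO_comp_const_mul {f : ℝ → E} {n : ℕ} (hf : f =O[𝓝 0] fun t : ℝ => t ^ n) (c : ℝ) :
    (fun h => f (c * h)) =O[𝓝 0] fun h : ℝ => h ^ n := by
  have ht : Tendsto (fun h : ℝ => c * h) (𝓝 0) (𝓝 0) := by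
    simpa using (continuous_const_mul c).tendsto 0
  refine (hf.comp_tendsto ht).trans ?_
  simp only [Function.comp_def, mul_pow]
  exact isBigO_const_mul_self _ _ _

lemma isBigO_pow_of_le {m n : ℕ} (h : m ≤ n) :
    (fun t : ℝ => t ^ n) =O[𝓝 0] fun t : ℝ => t ^ m := by
  rcases h.eq_or_lt with rfl | h
  · exact isBigO_refl _ _
  · exact (isLittleO_pow_pow h).isBigO

lemma isBigO_pow_smul_const {m n : ℕ} (h : m ≤ n) (c : ℝ) (v : E) :
    (fun t : ℝ => (c * t ^ n) • v) =O[𝓝 0] fun t : ℝ => t ^ m := by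
  refine IsBigO.trans ?_ (isBigO_pow_of_le h)
  refine IsBigO.of_bound (‖c‖ * ‖v‖) (Eventually.of_forall fun t => le_of_eq ?_)
  rw [norm_smul, norm_mul]
  ring

/-- The first-order expansion of a smooth map along two curves that agree to third order. -/
lemma isBigO_sub_sub_fderiv {G : E → E} (hG : ContDiff ℝ ∞ G) {x y : ℝ → E} {p : E}
    (hx : (fun h => x h - p) =O[𝓝 0] fun h : ℝ => h ^ 1)
    (hxy : (fun h => y h - x h) =O[𝓝 0] fun h : ℝ => h ^ 3) :
    (fun h => G (y h) - G (x h) - fderiv ℝ G p (y h - x h)) =O[𝓝 0] fun h : ℝ => h ^ 4 := by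
  have hd : DifferentiableAt ℝ (fderiv ℝ G) p :=
    ((hG.fderiv_right (m := ∞) (by simp)).differentiable (by simp)).differentiableAt
  obtain ⟨L, hL0, hL⟩ := hd.isBigO_sub.exists_pos
  rw [isBigOWith_iff] at hL
  obtain ⟨ε, hε, hball⟩ := Metric.eventually_nhds_iff_ball.1 hL
  have hy : (fun h => y h - p) =O[𝓝 0] fun h : ℝ => h ^ 1 := by
    have : (fun h => y h - p) = fun h => (y h - x h) + (x h - p) := by ext; abel
    rw [this]
    exact (hxy.trans (isBigO_pow_of_le (by norm_num))).add hx
  have hsum : (fun h => ‖x h - p‖ + ‖y h - p‖) =O[𝓝 0] fun h : ℝ => h ^ 1 :=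
    hx.norm_left.add hy.norm_left
  have hid : Tendsto (fun h : ℝ => h ^ 1) (𝓝 0) (𝓝 0) := by
    simpa using (continuous_pow 1).tendsto (0 : ℝ)
  have htx := hsum.trans_tendsto hid
  have : (fun h => G (y h) - G (x h) - fderiv ℝ G p (y h - x h))
      =O[𝓝 0] fun h => (‖x h - p‖ + ‖y h - p‖) * ‖y h - x h‖ := by
    refine IsBigO.of_bound L ?_
    filter_upwards [htx.eventually_lt_const hε] with h hh
    set ρ := ‖x h - p‖ + ‖y h - p‖ with hρ
    have hsub : Metric.closedBall p ρ ⊆ Metric.ball p ε := Metric.closedBall_subset_ball hh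
    -- On the ball of radius ρ the derivative differs from its value at `p` by at most Lρ; the mean
    -- value inequality turns this into an error O(h) · O(h³).
    have hmv := (convex_closedBall p ρ).norm_image_sub_le_of_norm_hasFDerivWithin_le'
      (f := G) (f' := fderiv ℝ G) (φ := fderiv ℝ G p) (C := L * ρ) (x := x h) (y := y h)
      (fun v _ => (hG.differentiable (by simp)).differentiableAt.hasFDerivAt.hasFDerivWithinAt)
      (fun v hv => by
        refine (hball v (hsub hv)).trans ?_
        gcongr
        simpa [dist_eq_norm] using hv)
      (by simp [hρ, dist_eq_norm]) (by simp [hρ, dist_eq_norm])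
    refine hmv.trans_eq ?_
    rw [norm_mul, norm_norm, Real.norm_of_nonneg (by positivity : 0 ≤ ρ), mul_assoc]
  refine this.trans ?_
  have := hsum.mul hxy.norm_left
  simpa only [← pow_add] using this

lemma solution_taylor {F : E → E} (hF : ContDiff ℝ ∞ F) {u : ℝ → E}
    (hu : ∀ᶠ t in 𝓝 0, HasDerivAt u (F (u t)) t) (n k : ℕ) (c : ℝ) :
    (fun h => lieDerivative F k (u (c * h)) - ∑ j ∈ Finset.range n,
      ((c * h) ^ j / j.factorial) • lieDerivative F (k + j) (u 0))
      =O[𝓝 0] fun h : ℝ => h ^ n :=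
  isBigO_comp_const_mul (taylor_isBigO (hasDerivAt_lieDerivative hF hu) n k) c

/-- Expansion of the second derivative at a stage that is accurate to second order. -/
lemma stage_expansion {F : E → E} (hF : ContDiff ℝ ∞ F) {u : ℝ → E}
    (hu : ∀ᶠ t in 𝓝 0, HasDerivAt u (F (u t)) t) {y : ℝ → E} {c γ : ℝ}
    (hy : (fun h => y h - u (c * h) - (γ * h ^ 3) • lieDerivative F 3 (u 0))
      =O[𝓝 0] fun h : ℝ => h ^ 4) :
    (fun h => lieDerivative F 2 (y h) - ∑ j ∈ Finset.range 4,
        ((c * h) ^ j / j.factorial) • lieDerivative F (2 + j) (u 0)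
      - (γ * h ^ 3) • fderiv ℝ (lieDerivative F 2) (u 0) (lieDerivative F 3 (u 0)))
      =O[𝓝 0] fun h : ℝ => h ^ 4 := by
  set T := fderiv ℝ (lieDerivative F 2) (u 0) with hT
  have h1 : (fun h => y h - u (c * h)) =O[𝓝 0] fun h : ℝ => h ^ 3 := by
    have := (hy.trans (isBigO_pow_of_le (by norm_num : 3 ≤ 4))).add
      (isBigO_pow_smul_const (le_refl 3) γ (lieDerivative F 3 (u 0)))
    simpa using this
  have h0 : (fun h => u (c * h) - u 0) =O[𝓝 0] fun h : ℝ => h ^ 1 := by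
    simpa [lieDerivative] using solution_taylor hF hu 1 0 c
  have h2 := isBigO_sub_sub_fderiv (contDiff_lieDerivative hF 2) h0 h1
  have h3 := solution_taylor hF hu 4 2 c
  have h4 := (T.isBigO_comp (fun h => y h - u (c * h) - (γ * h ^ 3) • lieDerivative F 3 (u 0))
    (𝓝 0)).trans hy
  refine ((h2.add h3).add h4).congr_left fun h => ?_
  simp only [map_sub, map_smul, ← hT]
  abel

/-- A simplified method that satisfies the order conditions has local error `O(h⁶)`. -/
theorem ReducedOrderConditions.local_error {a21 a31 ah21 ah31 ah32 bh1 bh2 bh3 : ℝ}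
    (hc : ReducedOrderConditions a21 a31 ah21 ah31 ah32 bh1 bh2 bh3)
    (h21 : ah21 = 1 / 2 * a21 ^ 2) (h31 : ah31 + ah32 = 1 / 2 * a31 ^ 2)
    {F : E → E} (hF : ContDiff ℝ ∞ F) {u : ℝ → E}
    (hu : ∀ᶠ t in 𝓝 0, HasDerivAt u (F (u t)) t) :
    (fun h : ℝ => (simplifiedMethod a21 a31 ah21 ah31 ah32 bh1 bh2 bh3).step F
      (fun v => fderiv ℝ F v (F v)) h (u 0) - u h) =O[𝓝 0] fun h : ℝ => h ^ 6 := by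
  rw [← lieDerivative_two]
  set M := simplifiedMethod a21 a31 ah21 ah31 ah32 bh1 bh2 bh3 with hM
  set G := lieDerivative F 2 with hG
  set w := F (u 0) with hw
  set g₀ := G (u 0) with hg₀
  set g₁ := lieDerivative F 3 (u 0) with hg₁
  set g₂ := lieDerivative F 4 (u 0) with hg₂
  set g₃ := lieDerivative F 5 (u 0) with hg₃
  set z := fderiv ℝ G (u 0) g₁ with hz
  have t4 : ∀ c, (fun h => u (c * h) - (u 0 + (c * h) • w + ((c * h) ^ 2 / 2) • g₀
      + ((c * h) ^ 3 / 6) • g₁)) =O[𝓝 0] fun h : ℝ => h ^ 4 := fun c => by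
    refine (solution_taylor hF hu 4 0 c).congr_left fun h => ?_
    simp [Finset.sum_range_succ, Nat.factorial, lieDerivative_one, hG, hg₀, hg₁, hw]
    simp [lieDerivative]
  have t6 : (fun h => u h - (u 0 + h • w + (h ^ 2 / 2) • g₀
      + (h ^ 3 / 6) • g₁ + (h ^ 4 / 24) • g₂ + (h ^ 5 / 120) • g₃))
      =O[𝓝 0] fun h : ℝ => h ^ 6 := by
    refine (solution_taylor hF hu 6 0 1).congr_left fun h => ?_
    simp [Finset.sum_range_succ, Nat.factorial, lieDerivative_one, hG, hg₀, hg₁, hg₂, hg₃, hw]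
    simp [lieDerivative]
  have stage : ∀ (y : ℝ → E) (c γ : ℝ),
      (fun h => y h - u (c * h) - (γ * h ^ 3) • g₁) =O[𝓝 0] (fun h : ℝ => h ^ 4) →
      (fun h => G (y h) - (g₀ + (c * h) • g₁ + ((c * h) ^ 2 / 2) • g₂
        + ((c * h) ^ 3 / 6) • g₃) - (γ * h ^ 3) • z) =O[𝓝 0] fun h : ℝ => h ^ 4 := by
    intro y c γ hy
    refine (stage_expansion hF hu hy).congr_left fun h => ?_
    simp [Finset.sum_range_succ, Nat.factorial, hG, hg₀, hg₁, hg₂, hg₃, hz]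
  have y2 : (fun h => M.stage F G h (u 0) 1 - u (a21 * h) - (-(a21 ^ 3 / 6) * h ^ 3) • g₁)
      =O[𝓝 0] fun h : ℝ => h ^ 4 := by
    refine (t4 a21).neg_left.congr_left fun h => ?_
    rw [hM, simplifiedMethod_stage_one, h21]
    module
  have r2 := stage _ _ _ y2
  -- The third stage multiplies this second derivative by h², so accuracy O(h²) is enough here.
  have r2' : (fun h => G (M.stage F G h (u 0) 1) - (g₀ + (a21 * h) • g₁))
      =O[𝓝 0] fun h : ℝ => h ^ 2 := by
    have := ((r2.trans (isBigO_pow_of_le (by norm_num : 2 ≤ 4))).add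
      (isBigO_pow_smul_const (le_refl 2) (a21 ^ 2 / 2) g₂)).add
      ((isBigO_pow_smul_const (by norm_num : 2 ≤ 3) (a21 ^ 3 / 6) g₃).add
      (isBigO_pow_smul_const (by norm_num : 2 ≤ 3) (-(a21 ^ 3 / 6)) z))
    refine this.congr_left fun h => ?_
    module
  have y3 : (fun h => M.stage F G h (u 0) 2 - u (a31 * h)
      - ((ah32 * a21 - a31 ^ 3 / 6) * h ^ 3) • g₁) =O[𝓝 0] fun h : ℝ => h ^ 4 := by
    have := (isBigO_const_mul_self ah32 (fun h : ℝ => h ^ 2) (𝓝 0)).smul r2'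
    simp only [smul_eq_mul, ← pow_add] at this
    refine (this.sub (t4 a31)).congr_left fun h => ?_
    rw [hM, simplifiedMethod_stage_two, show ah31 = 1 / 2 * a31 ^ 2 - ah32 by linarith]
    module
  have r3 := stage _ _ _ y3
  have := ((isBigO_refl (fun h : ℝ => h ^ 2) (𝓝 0)).smul
    ((r2.const_smul_left bh2).add (r3.const_smul_left bh3)))
  simp only [smul_eq_mul, ← pow_add] at this
  refine (this.sub t6).congr_left fun h => ?_
  rw [hM, simplifiedMethod_step, ← hM]
  obtain ⟨m0, m1, m2, m3, -, -, n⟩ := hc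
  simp only [← hw, ← hg₀, Pi.smul_apply]
  generalize G (M.stage F G h (u 0) 1) = x2
  generalize G (M.stage F G h (u 0) 2) = x3
  -- The g-terms match the Taylor series by the moments. The defects contribute h⁵ (-(b̂₂a₂₁³ +
  -- b̂₃a₃₁³)/6 + b̂₃â₃₂a₂₁) z, which is zero because 1/20 = 6 · 1/120.
  linear_combination (norm := module) (-h ^ 2 * m0) • g₀ + (-h ^ 3 * m1) • g₁ + (-h ^ 4 / 2 * m2) • g₂
    + (-h ^ 5 / 6 * m3) • g₃ + (h ^ 5 / 6 * m3 - h ^ 5 * n) • z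

end LocalError

section OrderFive

variable {a21 a31 ah21 ah31 ah32 bh1 bh2 bh3 : ℝ}

theorem hasOrder_five_iff_reduced :
    (simplifiedMethod a21 a31 ah21 ah31 ah32 bh1 bh2 bh3).HasOrder 5 ↔
      ReducedOrderConditions a21 a31 ah21 ah31 ah32 bh1 bh2 bh3 := by
  refine ⟨reducedOrderConditions_of_hasOrder, fun hc d F hF u hu => ?_⟩
  obtain ⟨-, h21, h31, h32, h31', -⟩ := reducedOrderConditions_iff.1 hc
  refine (hc.local_error h21 ?_ hF hu).mono nhdsWithin_le_nhds
  rw [h31', h32, FifthOrder.Admissible.ah31_add, h31]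

end OrderFive

/-! ### The matrices R, P, Q for the family -/

section SimplifiedSSP

variable {a21 a31 ah21 ah31 ah32 bh1 bh2 bh3 : ℝ}

/-- Forward substitution for the bordered system of a simplified method. -/
lemma simplifiedMethod_R_mulVec (K r : ℝ) (y : Fin 3 ⊕ Unit → ℝ) :
    let x := (simplifiedMethod a21 a31 ah21 ah31 ah32 bh1 bh2 bh3).R K r *ᵥ y
    x (Sum.inl 0) = y (Sum.inl 0) ∧
    x (Sum.inl 1) = y (Sum.inl 1) - (r * a21 + r ^ 2 / K ^ 2 * ah21) * x (Sum.inl 0) ∧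
    x (Sum.inl 2) = y (Sum.inl 2) - (r * a31 + r ^ 2 / K ^ 2 * ah31) * x (Sum.inl 0)
      - r ^ 2 / K ^ 2 * ah32 * x (Sum.inl 1) ∧
    x (Sum.inr ()) = y (Sum.inr ()) - (r + r ^ 2 / K ^ 2 * bh1) * x (Sum.inl 0)
      - r ^ 2 / K ^ 2 * bh2 * x (Sum.inl 1) - r ^ 2 / K ^ 2 * bh3 * x (Sum.inl 2) := by
  intro x
  have h : (simplifiedMethod a21 a31 ah21 ah31 ah32 bh1 bh2 bh3).T K r *ᵥ x = y := by
    rw [Matrix.mulVec_mulVec, TwoDerivMethod.T_mul_R, Matrix.one_mulVec]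
  clear_value x
  subst h
  simp only [TwoDerivMethod.T, TwoDerivMethod.S, TwoDerivMethod.Shat, simplifiedMethod, mulVec,
    dotProduct, Fintype.sum_sum_type, Fin.sum_univ_three, Finset.univ_unique, Finset.sum_singleton,
    Matrix.add_apply, Matrix.smul_apply, Matrix.one_apply, fromBlocks_apply₁₁, fromBlocks_apply₁₂,
    fromBlocks_apply₂₁, fromBlocks_apply₂₂, smul_eq_mul]
  refine ⟨?_, ?_, ?_, ?_⟩ <;> simp <;> ring

lemma TwoDerivMethod.P_apply {s : ℕ} (M : TwoDerivMethod s) (K r : ℝ) (i j : Fin s ⊕ Unit) :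
    M.P K r i j = r * (M.R K r *ᵥ fun l => M.S l j) i := rfl

lemma TwoDerivMethod.Q_apply {s : ℕ} (M : TwoDerivMethod s) (K r : ℝ) (i j : Fin s ⊕ Unit) :
    M.Q K r i j = r ^ 2 / K ^ 2 * (M.R K r *ᵥ fun l => M.Shat l j) i := rfl

end SimplifiedSSP

namespace FifthOrder

variable {K r a : ℝ}

lemma family_R_mulVec (K r a : ℝ) (y : Fin 3 ⊕ Unit → ℝ) :
    let x := (family a).R K r *ᵥ y
    x (Sum.inl 0) = y (Sum.inl 0) ∧
    x (Sum.inl 1) = y (Sum.inl 1) - (r * a + r ^ 2 / K ^ 2 * ah21 a) * x (Sum.inl 0) ∧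
    x (Sum.inl 2) = y (Sum.inl 2) - (r * a31 a + r ^ 2 / K ^ 2 * ah31 a) * x (Sum.inl 0)
      - r ^ 2 / K ^ 2 * ah32 a * x (Sum.inl 1) ∧
    x (Sum.inr ()) = y (Sum.inr ()) - (r + r ^ 2 / K ^ 2 * bh1 a) * x (Sum.inl 0)
      - r ^ 2 / K ^ 2 * bh2 a * x (Sum.inl 1) - r ^ 2 / K ^ 2 * bh3 a * x (Sum.inl 2) :=
  simplifiedMethod_R_mulVec K r y

/-- Forward substitution produces exactly the combinations of coefficients that the order conditions
evaluate, so only `a` survives from the method. -/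
lemma family_Re_last (ha : Admissible a) :
    (family a).Re K r (Sum.inr ()) = 1 - r - r ^ 2 / K ^ 2 / 2 + r ^ 2 / K ^ 2 * r / 6
      + (r ^ 2 / K ^ 2) ^ 2 / 24 - (r ^ 2 / K ^ 2) ^ 2 * r / 120
      - (r ^ 2 / K ^ 2) ^ 3 * a / 240 := by
  obtain ⟨h0, h1, h2, h3⟩ := family_R_mulVec K r a 1
  obtain ⟨m0, m1, m2, m3, s0, s1, n⟩ := ha.reducedOrderConditions
  rw [TwoDerivMethod.Re, h3, h2, h1, h0]
  simp only [Pi.one_apply]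
  generalize r ^ 2 / K ^ 2 = k
  rw [ah21] at s0 ⊢
  linear_combination (-k) * m0 + k * r * m1 + k ^ 2 * s0 - k ^ 2 * (r + k * a / 2) * n

lemma family_Re_last_eq_zero_iff (hK : 0 < K) (hr : 0 < r) (ha : Admissible a) :
    (family a).Re K r (Sum.inr ()) = 0 ↔ a = a21Of K r := by
  rw [family_Re_last ha, a21Of]
  field_simp
  constructor <;> intro h <;> linarith

/-- The factor in front of `qPoly` is `ah32 a / nodeQuadratic a`, which is nonzero for admissible
`a`; its sign matters for the necessary condition below. -/
lemma family_Q_two_zero (ha : Admissible a) (hK : 0 < K) :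
    (family a).Q K r (Sum.inl 2) (Sum.inl 0) = -(r ^ 2 / K ^ 2 *
      ((3 / 5 - a) / (10 * a * (1 - 2 * a) ^ 3) * (qPoly K r a / (10 * K ^ 2)))) := by
  obtain ⟨h0, h1, h2, -⟩ := family_R_mulVec K r a
    fun l => (family a).Shat l (Sum.inl 0)
  have e : ah31 a = 1 / 2 * a31 a ^ 2 - ah32 a := eq_sub_of_add_eq Admissible.ah31_add
  have := ha.one_sub_ne'
  have := ha.1
  rw [TwoDerivMethod.Q_apply, h2, h1, h0]
  simp [family, simplifiedMethod, TwoDerivMethod.Shat]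
  rw [e, ha.ah32_eq, a31, ah21, nodeQuadratic, qPoly]
  field_simp
  ring

/-- The relation between `a`, `r` and `k = r² / K²` equivalent to `a = a₂₁(K, r)`. -/
lemma eq_a21Of_iff (hK : 0 < K) (hr : 0 < r) : a = a21Of K r ↔
    r * (1 - r ^ 2 / K ^ 2 / 6 + (r ^ 2 / K ^ 2) ^ 2 / 120) = 1 - r ^ 2 / K ^ 2 / 2
      + (r ^ 2 / K ^ 2) ^ 2 / 24 - (r ^ 2 / K ^ 2) ^ 3 * a / 240 := by
  rw [a21Of]
  field_simp
  constructor <;> intro h <;> linarith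

/-- The coefficient of k is positive for a ≠ 0, so at a root with k > 0 the cubic 100 (a - 3/10)(a²
- a + 1/5) must be positive. -/
lemma qPoly_eq (hK : 0 < K) : qPoly K r a = K ^ 2 * (r ^ 2 / K ^ 2 * (a ^ 2 *
    (10 * a ^ 2 - 10 * a + 3)) - 100 * (a - 3 / 10) * (a ^ 2 - a + 1 / 5)) := by
  rw [qPoly]
  field_simp
  ring

/-- Re and, up to nonnegative factors, the columns of P and Q all have the form R y; the numbers x₀
to x₃ are the outcome of forward substitution. -/
lemma family_R_mulVec_nonneg {y : Fin 3 ⊕ Unit → ℝ} (x₀ x₁ x₂ x₃ : ℝ)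
    (e₀ : y (Sum.inl 0) = x₀) (e₁ : y (Sum.inl 1) - (r * a + r ^ 2 / K ^ 2 * ah21 a) * x₀ = x₁)
    (e₂ : y (Sum.inl 2) - (r * a31 a + r ^ 2 / K ^ 2 * ah31 a) * x₀
      - r ^ 2 / K ^ 2 * ah32 a * x₁ = x₂)
    (e₃ : y (Sum.inr ()) - (r + r ^ 2 / K ^ 2 * bh1 a) * x₀
      - r ^ 2 / K ^ 2 * bh2 a * x₁ - r ^ 2 / K ^ 2 * bh3 a * x₂ = x₃)
    (h₀ : 0 ≤ x₀) (h₁ : 0 ≤ x₁) (h₂ : 0 ≤ x₂) (h₃ : 0 ≤ x₃) (i : Fin 3 ⊕ Unit) :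
    0 ≤ ((family a).R K r *ᵥ y) i := by
  obtain ⟨f₀, f₁, f₂, f₃⟩ := family_R_mulVec K r a y
  rw [e₀] at f₀
  rw [f₀, e₁] at f₁
  rw [f₀, f₁, e₂] at f₂
  rw [f₀, f₁, f₂, e₃] at f₃
  rcases i with i | i
  · fin_cases i
    exacts [h₀.trans_eq f₀.symm, h₁.trans_eq f₁.symm, h₂.trans_eq f₂.symm]
  · exact h₃.trans_eq f₃.symm

/-- The third entry equals the left-out expression 1 - r a₃₁ - k a₃₁²/2 plus k â₃₂ (r a + k a²/2),
and the latter only helps. -/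
lemma family_Re_nonneg (hRe : (family a).Re K r (Sum.inr ()) = 0) (h32 : 0 ≤ ah32 a)
    (hr : 0 ≤ r) (ha : 0 ≤ a) (h1 : 0 ≤ 1 - r * a - r ^ 2 / K ^ 2 * a ^ 2 / 2)
    (h2 : 0 ≤ 1 - r * a31 a - r ^ 2 / K ^ 2 * a31 a ^ 2 / 2) (i : Fin 3 ⊕ Unit) :
    0 ≤ (family a).Re K r i := by
  refine family_R_mulVec_nonneg _ _ _ _ rfl rfl rfl rfl ?_ ?_ ?_ ?_ i
  · exact zero_le_one
  · simp only [Pi.one_apply, ah21]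
    linarith
  · simp only [Pi.one_apply, ah21, show ah31 a = 1 / 2 * a31 a ^ 2 - ah32 a from
      eq_sub_of_add_eq Admissible.ah31_add]
    have : 0 ≤ r ^ 2 / K ^ 2 * ah32 a * (r * a + r ^ 2 / K ^ 2 * (1 / 2 * a ^ 2)) := by
      positivity
    linarith
  · obtain ⟨f₀, f₁, f₂, f₃⟩ := family_R_mulVec K r a 1
    rw [TwoDerivMethod.Re] at hRe
    rw [f₀] at f₁
    rw [f₀, f₁] at f₂
    rw [f₀, f₁, f₂, hRe] at f₃
    exact f₃.le

/-- `F` is evaluated only at the first stage, so a single column of `S` is nonzero. The last entry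
of R applied to it is 1 - k/6 + k²/120, which has no real zero. -/
lemma family_P_nonneg (ha : Admissible a) (hr : 0 ≤ r) (ha0 : 0 ≤ a)
    (h : r ^ 2 / K ^ 2 * ah32 a * a ≤ a31 a) (i j : Fin 3 ⊕ Unit) :
    0 ≤ (family a).P K r i j := by
  obtain ⟨-, m1, -, -, -, -, n⟩ := ha.reducedOrderConditions
  rw [TwoDerivMethod.P_apply]
  refine mul_nonneg hr ?_
  have hk : 0 ≤ 1 - r ^ 2 / K ^ 2 / 6 + (r ^ 2 / K ^ 2) ^ 2 / 120 := by
    nlinarith [sq_nonneg (r ^ 2 / K ^ 2 - 10)]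
  rcases j with j | j
  · fin_cases j
    · refine family_R_mulVec_nonneg 0 a (a31 a - r ^ 2 / K ^ 2 * ah32 a * a)
        (1 - r ^ 2 / K ^ 2 / 6 + (r ^ 2 / K ^ 2) ^ 2 / 120) ?_ ?_ ?_ ?_ le_rfl ha0 ?_ hk i
      · simp [family, simplifiedMethod, TwoDerivMethod.S]
      · simp [family, simplifiedMethod, TwoDerivMethod.S]
      · simp [family, simplifiedMethod, TwoDerivMethod.S]
      · simp only [TwoDerivMethod.S, fromBlocks_apply₂₁, family, simplifiedMethod, Matrix.of_apply]
        simp only [Fin.zero_eta, Matrix.cons_val_zero]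
        linear_combination -(r ^ 2 / K ^ 2) * m1 + (r ^ 2 / K ^ 2) ^ 2 * n
      · linarith
    all_goals
      refine family_R_mulVec_nonneg 0 0 0 0 ?_ ?_ ?_ ?_ le_rfl le_rfl le_rfl le_rfl i <;>
        simp [family, simplifiedMethod, TwoDerivMethod.S]
  · refine family_R_mulVec_nonneg 0 0 0 0 ?_ ?_ ?_ ?_ le_rfl le_rfl le_rfl le_rfl i <;>
      simp [TwoDerivMethod.S]

/-- Because Q₃₁ = 0, the weight b̂₃ drops out of the last entry of the first column, which leaves
the condition `q1`. -/
lemma family_Q_nonneg (hk : 0 < r ^ 2 / K ^ 2)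
    (hQ : (family a).Q K r (Sum.inl 2) (Sum.inl 0) = 0) (h32 : 0 ≤ ah32 a) (hb3 : 0 ≤ bh3 a)
    (q4 : r ^ 2 / K ^ 2 * bh3 a * ah32 a ≤ bh2 a)
    (q1 : r ^ 2 / K ^ 2 * bh2 a * (1 / 2 * a ^ 2) ≤ bh1 a) (i j : Fin 3 ⊕ Unit) :
    0 ≤ (family a).Q K r i j := by
  rw [TwoDerivMethod.Q_apply] at hQ ⊢
  refine mul_nonneg hk.le ?_
  rcases j with j | j
  · fin_cases j
    · have hQ' := (mul_eq_zero.1 hQ).resolve_left hk.ne'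
      obtain ⟨f₀, f₁, f₂, -⟩ := family_R_mulVec K r a fun l => (family a).Shat l (Sum.inl 0)
      rw [f₀] at f₁
      rw [hQ', f₀, f₁] at f₂
      have e₂ : ah31 a - r ^ 2 / K ^ 2 * ah32 a * ah21 a = 0 := by
        simpa [family, simplifiedMethod, TwoDerivMethod.Shat] using f₂.symm
      refine family_R_mulVec_nonneg 0 (1 / 2 * a ^ 2) 0
        (bh1 a - r ^ 2 / K ^ 2 * bh2 a * (1 / 2 * a ^ 2)) ?_ ?_ ?_ ?_ le_rfl (by positivity)
        le_rfl (by linarith) i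
      · simp [family, simplifiedMethod, TwoDerivMethod.Shat]
      · simp [family, simplifiedMethod, TwoDerivMethod.Shat, ah21]
      · rw [ah21] at e₂
        simp [family, simplifiedMethod, TwoDerivMethod.Shat]
        linarith
      · simp [family, simplifiedMethod, TwoDerivMethod.Shat]
    · refine family_R_mulVec_nonneg 0 0 (ah32 a) (bh2 a - r ^ 2 / K ^ 2 * bh3 a * ah32 a)
        ?_ ?_ ?_ ?_ le_rfl le_rfl h32 (by linarith) i <;>
        simp [family, simplifiedMethod, TwoDerivMethod.Shat]
    · refine family_R_mulVec_nonneg 0 0 0 (bh3 a) ?_ ?_ ?_ ?_ le_rfl le_rfl le_rfl hb3 i <;>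
        simp [family, simplifiedMethod, TwoDerivMethod.Shat]
  · refine family_R_mulVec_nonneg 0 0 0 0 ?_ ?_ ?_ ?_ le_rfl le_rfl le_rfl le_rfl i <;>
      simp [TwoDerivMethod.Shat]

/-- Sufficient conditions for the SSP conditions of a member of the family. -/
lemma family_SSPConditions (hK : 0 < K) (hr : 0 < r) (ha : Admissible a) (ha0 : 0 < a)
    (hnode : 0 < a31 a)
    (hRe : (family a).Re K r (Sum.inr ()) = 0)
    (hQ : (family a).Q K r (Sum.inl 2) (Sum.inl 0) = 0)
    (h1 : 0 ≤ 1 - r * a - r ^ 2 / K ^ 2 * a ^ 2 / 2)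
    (h2 : 0 ≤ 1 - r * a31 a - r ^ 2 / K ^ 2 * a31 a ^ 2 / 2)
    (h3 : r ^ 2 / K ^ 2 * nodeQuadratic a ≤ 10 * (1 - 2 * a) ^ 2)
    (h4 : r ^ 2 / K ^ 2 * nodeQuadratic a ≤ 2)
    (h5 : r ^ 2 / K ^ 2 * a / (120 * nodeQuadratic a) ≤ bh1 a) :
    (family a).SSPConditions K r := by
  obtain ⟨m0, m1, m2, m3, s0, s1, n⟩ := ha.reducedOrderConditions
  have hD := nodeQuadratic_pos a
  have hk' : 0 < r ^ 2 / K ^ 2 := by positivity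
  have h12 : 0 < (1 - 2 * a) ^ 2 := by have := ha.one_sub_ne; positivity
  have e32 : ah32 a = a31 a * nodeQuadratic a / (10 * a * (1 - 2 * a) ^ 2) := by
    have := ha.one_sub_ne'
    rw [ha.ah32_eq, a31]
    field_simp
  have h32 : 0 < ah32 a := by rw [e32]; positivity
  have hb3 : 0 < bh3 a := by
    refine pos_of_mul_pos_left (?_ : 0 < bh3 a * (ah32 a * a)) (by positivity)
    rw [n]; norm_num
  have p3 : r ^ 2 / K ^ 2 * ah32 a * a ≤ a31 a := by
    rw [e32]
    have : r ^ 2 / K ^ 2 * (a31 a * nodeQuadratic a / (10 * a * (1 - 2 * a) ^ 2)) * a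
        = a31 a * (r ^ 2 / K ^ 2 * nodeQuadratic a / (10 * (1 - 2 * a) ^ 2)) := by
      field_simp
    rw [this]
    refine mul_le_of_le_one_right hnode.le ?_
    rw [div_le_one (by positivity)]
    exact h3
  have n' : bh3 a * ah32 a = 1 / (120 * a) := by
    rw [eq_div_iff (by positivity)]
    linear_combination 120 * n
  have q4 : r ^ 2 / K ^ 2 * bh3 a * ah32 a ≤ bh2 a := by
    -- The product b̂₃â₃₂ is fixed by the nested condition, so the inequality becomes k ·
    -- `nodeQuadratic a` ≤ 2.
    rw [mul_assoc, n', ha.bh2_eq, mul_one_div, div_le_div_iff₀ (by positivity) (by positivity)]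
    nlinarith [mul_le_mul_of_nonneg_left h4 ha0.le]
  have q1 : r ^ 2 / K ^ 2 * bh2 a * (1 / 2 * a ^ 2) ≤ bh1 a := by
    refine le_of_eq_of_le ?_ h5
    rw [ha.bh2_eq]
    field_simp
    norm_num
  exact ⟨family_Re_nonneg hRe h32.le hr.le ha0.le h1 h2, family_P_nonneg ha hr.le ha0.le p3,
    family_Q_nonneg hk' hQ h32.le hb3.le q4 q1⟩

/-- Necessary conditions for the SSP conditions of a member of the family. -/
lemma qPoly_nonpos_of_SSPConditions (hK : 0 < K) (hr : 0 < r) (ha : Admissible a)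
    (h : (family a).SSPConditions K r) : qPoly K r a ≤ 0 := by
  obtain ⟨-, hP, hQ⟩ := h
  have hk : 0 < r ^ 2 / K ^ 2 := by positivity
  have hD := nodeQuadratic_pos a
  have ha0 : 0 < a := by
    refine lt_of_le_of_ne ?_ ha.1.symm
    have := hP (Sum.inl 1) (Sum.inl 0)
    obtain ⟨f₀, f₁, -, -⟩ := family_R_mulVec K r a fun l => (family a).S l (Sum.inl 0)
    rw [TwoDerivMethod.P_apply, f₁, f₀] at this
    refine nonneg_of_mul_nonneg_right (?_ : 0 ≤ r * a) hr
    simpa [family, simplifiedMethod, TwoDerivMethod.S] using this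
  have hb3 : 0 ≤ bh3 a := by
    have := hQ (Sum.inr ()) (Sum.inl 2)
    obtain ⟨f₀, f₁, f₂, f₃⟩ := family_R_mulVec K r a fun l => (family a).Shat l (Sum.inl 2)
    rw [TwoDerivMethod.Q_apply, f₃, f₂, f₁, f₀] at this
    refine nonneg_of_mul_nonneg_right (?_ : 0 ≤ r ^ 2 / K ^ 2 * bh3 a) hk
    simpa [family, simplifiedMethod, TwoDerivMethod.Shat] using this
  -- This factor is `bh3 a` times a positive quantity, so the entry of Q that isolates `bh3 a`
  -- determines its sign.
  have hfac : 0 < (3 / 5 - a) / (10 * a * (1 - 2 * a) ^ 3) := by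
    have hsub := ha.sub_ne
    have hone := ha.one_sub_ne
    have : bh3 a = (1 - 2 * a) ^ 6 / (120 * a * nodeQuadratic a * (3 / 5 - a) ^ 2)
        * ((3 / 5 - a) / (10 * a * (1 - 2 * a) ^ 3)) * (100 * a ^ 2) := by
      have := ha.sub_ne'
      have := ha.one_sub_ne'
      rw [ha.bh3_eq]
      field_simp
      norm_num
    rw [this] at hb3
    have h6 : 0 < (1 - 2 * a) ^ 6 := by positivity
    refine lt_of_le_of_ne ?_ (by positivity : (3 / 5 - a) / (10 * a * (1 - 2 * a) ^ 3) ≠ 0).symm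
    have := nonneg_of_mul_nonneg_left hb3 (by positivity)
    exact nonneg_of_mul_nonneg_right this (by positivity)
  have := hQ (Sum.inl 2) (Sum.inl 0)
  rw [family_Q_two_zero ha hK] at this
  by_contra! hq
  have : 0 < r ^ 2 / K ^ 2 * ((3 / 5 - a) / (10 * a * (1 - 2 * a) ^ 3)
    * (qPoly K r a / (10 * K ^ 2))) := by positivity
  linarith

lemma family_Q_eq_zero_iff (hK : 0 < K) (hr : 0 < r) (ha : Admissible a) :
    (family a).Q K r (Sum.inl 2) (Sum.inl 0) = 0 ↔ qPoly K r a = 0 := by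
  have h1 := ha.one_sub_ne
  have h2 := ha.sub_ne
  have h3 := ha.1
  rw [family_Q_two_zero ha hK]
  simp [hK.ne', hr.ne', h1, h2, h3]

end FifthOrder

/-! ### Localisation of the roots and the SSP inequalities there -/

namespace FifthOrder

variable {K r a k : ℝ}

/-- With a replaced by 18/25 the cubic in k is decreasing, and 49/20 lies just beyond its zero. -/
lemma lt_of_numerator_pos (ha : 18 / 25 ≤ a)
    (h : 0 < 1 - k / 2 + k ^ 2 / 24 - k ^ 3 * a / 240) (hk : 0 ≤ k) : k < 49 / 20 := by
  by_contra! hle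
  have h3 : k ^ 3 * (18 / 25) ≤ k ^ 3 * a := by gcongr
  nlinarith [mul_nonneg (sub_nonneg.2 hle) (sq_nonneg (k - 9)), sq_nonneg (k - 5), mul_nonneg (sub_nonneg.2 hle) hk]

lemma denominator_pos (k : ℝ) : 0 < 1 - k / 6 + k ^ 2 / 120 := by
  nlinarith [sq_nonneg (k - 10)]

/-- The right side minus the factor of r is -(k/3)(1 - k/10) - k³a/240, which is nonpositive for 0 ≤
k ≤ 10. -/
lemma le_one_of_eq (hk : 0 ≤ k) (hk' : k ≤ 10) (ha : 0 ≤ a)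
    (h : r * (1 - k / 6 + k ^ 2 / 120) = 1 - k / 2 + k ^ 2 / 24 - k ^ 3 * a / 240) : r ≤ 1 := by
  have hD := denominator_pos k
  have : 0 ≤ k ^ 3 * a := by positivity
  by_contra! hr
  nlinarith [mul_lt_mul_of_pos_right hr hD]

/-- The two ranges of `a₂₁` in which the roots of `qPoly` relevant here lie. -/
lemma range_of_root (hk : 0 < k) (hr : 0 < r) (ha : a < 81 / 100)
    (h : r * (1 - k / 6 + k ^ 2 / 120) = 1 - k / 2 + k ^ 2 / 24 - k ^ 3 * a / 240)
    (hq : k * (a ^ 2 * (10 * a ^ 2 - 10 * a + 3))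
      = 100 * (a - 3 / 10) * (a ^ 2 - a + 1 / 5)) :
    (27 / 100 < a ∧ a < 3 / 10 ∧ k < 1 / 2) ∨ (18 / 25 < a ∧ k < 49 / 20) := by
  have hq' : 0 < 10 * a ^ 2 - 10 * a + 3 := by nlinarith [sq_nonneg (2 * a - 1)]
  have ha0 : a ≠ 0 := by
    rintro rfl
    norm_num at hq
  have hpos : 0 < 100 * (a - 3 / 10) * (a ^ 2 - a + 1 / 5) := by rw [← hq]; positivity
  -- The zeros of a² - a + 1/5 are about 0.2764 and 0.7236, so positivity of the cubic leaves a
  -- slightly below 3/10 or a above 0.7236; 27/100 and 18/25 are rational lower bounds.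
  rcases lt_or_ge a (3 / 10) with h3 | h3
  · left
    have hneg : a ^ 2 - a + 1 / 5 < 0 := by
      by_contra! hle
      nlinarith
    have h27 : 27 / 100 < a := by
      by_contra! hle
      nlinarith
    refine ⟨h27, h3, ?_⟩
    by_contra! hle
    have h1 : 100 * (a - 3 / 10) * (a ^ 2 - a + 1 / 5) ≤ 100 * (3 / 100) * (1 / 100) := by
      nlinarith
    have h2 : (729 : ℝ) / 10000 ≤ a ^ 2 := by nlinarith
    have h4 : (9 : ℝ) / 10 ≤ 10 * a ^ 2 - 10 * a + 3 := by nlinarith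
    have h5 : (1 / 2 : ℝ) * (729 / 10000 * (9 / 10)) ≤ k * (a ^ 2 * (10 * a ^ 2 - 10 * a + 3)) := by
      gcongr
    linarith
  · right
    have h72 : 18 / 25 < a := by
      by_contra! hle
      have hneg : a ^ 2 - a + 1 / 5 < 0 := by
        nlinarith [mul_nonneg (sub_nonneg.2 h3) (sub_nonneg.2 hle)]
      exact absurd hpos (not_lt.2 (mul_nonpos_of_nonneg_of_nonpos (by linarith) hneg.le))
    refine ⟨h72, lt_of_numerator_pos h72.le ?_ hk.le⟩
    rw [← h]
    exact mul_pos hr (denominator_pos k)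

lemma bh1_eq (ha : Admissible a) :
    bh1 a = (8 * a - 10 * a ^ 2 - 1) / (60 * a * (3 / 5 - a)) := by
  have := ha.1
  have := ha.sub_ne
  have := ha.sub_ne'
  have hD := (nodeQuadratic_pos a).ne'
  rw [bh1, ha.bh2_eq, ha.bh3_eq]
  field_simp
  rw [nodeQuadratic]
  ring

/-- Multiplying by the positive factor of r in the relation eliminates r; with the extreme values of
a inserted, a polynomial inequality in k remains. -/
lemma first_stage_bound (hk : 0 ≤ k) (hk' : k ≤ 49 / 20) (ha : 18 / 25 ≤ a) (ha' : a ≤ 81 / 100)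
    (h : r * (1 - k / 6 + k ^ 2 / 120) = 1 - k / 2 + k ^ 2 / 24 - k ^ 3 * a / 240) (hr : 0 ≤ r) :
    0 ≤ 1 - r * a - k * a ^ 2 / 2 := by
  have hD := denominator_pos k
  have h1 : r * a ≤ r * (81 / 100) := by gcongr
  have h2 : k * a ^ 2 ≤ k * (81 / 100) ^ 2 := by gcongr
  suffices 0 ≤ 1 - r * (81 / 100) - k * (81 / 100) ^ 2 / 2 by linarith
  have h3 : k ^ 3 * (18 / 25) ≤ k ^ 3 * a := by gcongr
  refine nonneg_of_mul_nonneg_left (?_ : 0 ≤ (1 - r * (81 / 100) - k * (81 / 100) ^ 2 / 2)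
    * (1 - k / 6 + k ^ 2 / 120)) hD
  nlinarith [sq_nonneg (k - 3 / 2), mul_nonneg hk (sq_nonneg k), mul_nonneg (mul_nonneg hk hk) (sub_nonneg.2 hk')]

theorem family_SSPConditions_of_root (hK : 0 < K) (hr : 0 < r) (hadm : Admissible a)
    (ha : a < 81 / 100) (hRe : a = a21Of K r) (hq : qPoly K r a = 0) :
    (family a).SSPConditions K r := by
  have hRe' := (family_Re_last_eq_zero_iff hK hr hadm).2 hRe
  have hQ' := (family_Q_eq_zero_iff hK hr hadm).2 hq
  rw [eq_a21Of_iff hK hr] at hRe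
  rw [qPoly_eq hK, mul_eq_zero, or_iff_right (by positivity), sub_eq_zero] at hq
  have hk : 0 < r ^ 2 / K ^ 2 := by positivity
  have hD := nodeQuadratic_pos a
  rcases range_of_root hk hr ha hRe hq with ⟨h1, h2, h3⟩ | ⟨h1, h2⟩
  · have hr1 : r ≤ 1 := le_one_of_eq hk.le (by linarith) (by linarith) hRe
    have ha0 : 0 < a := by linarith
    have h31 : 0 < a31 a := div_pos (by linarith) (by linarith)
    have h31' : a31 a ≤ 3 / 4 := by
      rw [a31, div_le_iff₀ (by linarith)]; linarith
    have hD2 : nodeQuadratic a ≤ 21 / 100 := by rw [nodeQuadratic]; nlinarith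
    have hD3 : 18 / 100 ≤ nodeQuadratic a := by rw [nodeQuadratic]; nlinarith
    refine family_SSPConditions hK hr hadm ha0 h31 hRe' hQ' ?_ ?_ ?_ ?_ ?_ <;>
      generalize r ^ 2 / K ^ 2 = k at *
    · have : r * a ≤ 1 * (3 / 10) := by gcongr
      have : k * a ^ 2 ≤ 1 / 2 * (3 / 10) ^ 2 := by gcongr
      linarith
    · have : r * a31 a ≤ 1 * (3 / 4) := by gcongr
      have : k * a31 a ^ 2 ≤ 1 / 2 * (3 / 4) ^ 2 := by gcongr
      linarith
    · have : k * nodeQuadratic a ≤ 1 / 2 * (21 / 100) := by gcongr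
      nlinarith
    · have : k * nodeQuadratic a ≤ 1 / 2 * (21 / 100) := by gcongr
      linarith
    · have e1 : k * a / (120 * nodeQuadratic a) ≤ 1 / 2 * (3 / 10) / (120 * (18 / 100)) := by
        gcongr
      refine e1.trans ?_
      rw [bh1_eq hadm, le_div_iff₀ (by nlinarith)]
      nlinarith
  · have hr1 : r ≤ 1 := le_one_of_eq hk.le (by linarith) (by linarith) hRe
    have ha0 : 0 < a := by linarith
    have h31 : 0 < a31 a := div_pos_of_neg_of_neg (by linarith) (by linarith)
    have h31' : a31 a ≤ 7 / 20 := by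
      rw [a31, div_le_iff_of_neg (by linarith)]; linarith
    have hD2 : nodeQuadratic a ≤ 3 / 10 := by rw [nodeQuadratic]; nlinarith
    refine family_SSPConditions hK hr hadm ha0 h31 hRe' hQ' ?_ ?_ ?_ ?_ ?_ <;>
      generalize r ^ 2 / K ^ 2 = k at *
    · exact first_stage_bound hk.le h2.le h1.le ha.le hRe hr.le
    · have : r * a31 a ≤ 1 * (7 / 20) := by gcongr
      have : k * a31 a ^ 2 ≤ 49 / 20 * (7 / 20) ^ 2 := by gcongr
      linarith
    · have : k * nodeQuadratic a ≤ 49 / 20 * (3 / 10) := by gcongr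
      nlinarith
    · have : k * nodeQuadratic a ≤ 49 / 20 * (3 / 10) := by gcongr
      linarith
    · have e1 : k * a / (120 * nodeQuadratic a) ≤ 49 / 20 * a / (120 * nodeQuadratic a) := by
        gcongr
      refine e1.trans ?_
      -- Here a > 3/5, so numerator and denominator change sign together to make the denominator
      -- positive.
      have e2 : (8 * a - 10 * a ^ 2 - 1) / (60 * a * (3 / 5 - a))
          = (10 * a ^ 2 - 8 * a + 1) / (60 * a * (a - 3 / 5)) := by
        rw [← neg_div_neg_eq]; congr 1 <;> ring
      have : 0 < a - 3 / 5 := by linarith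
      rw [bh1_eq hadm, e2, div_le_div_iff₀ (by positivity) (by positivity), nodeQuadratic]
      obtain ⟨t, rfl⟩ : ∃ t, a = 18 / 25 + t := ⟨a - 18 / 25, by ring⟩
      have ht : 0 < t := by linarith
      nlinarith [pow_pos ht 2, pow_pos ht 3, pow_pos ht 4]

/-! ### The largest root -/

lemma continuousOn_a21Of (K : ℝ) : ContinuousOn (a21Of K) (Ioi 0) := by
  have h : ∀ r ∈ Ioi (0 : ℝ), r ^ 6 ≠ 0 := fun r hr => pow_ne_zero _ (ne_of_gt hr)
  unfold a21Of
  fun_prop (disch := assumption)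

lemma continuousOn_qPoly (K : ℝ) : ContinuousOn (fun r => qPoly K r (a21Of K r)) (Ioi 0) := by
  have := continuousOn_a21Of K
  unfold qPoly
  fun_prop

/-- Beyond `r = 10` there are no roots. -/
lemma qPoly_pos_of_ten_le (hK : 0 < K) (hr : 10 ≤ r) : 0 < qPoly K r (a21Of K r) := by
  have hr0 : 0 < r := by linarith
  -- For r ≥ 10 the left side of the relation exceeds the a-free part of the right side, so a ≤ 0.
  -- As `qPoly` has alternating signs in a, each of its terms is then nonnegative.
  have ha : a21Of K r ≤ 0 := by
    have h := (eq_a21Of_iff (a := a21Of K r) hK hr0).1 rfl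
    have hk : 0 < r ^ 2 / K ^ 2 := by positivity
    generalize r ^ 2 / K ^ 2 = k at *
    by_contra! hpos
    have h3 : 0 < k ^ 3 * a21Of K r := by positivity
    have h4 := mul_le_mul_of_nonneg_right hr (denominator_pos k).le
    nlinarith [sq_nonneg (k - 14)]
  generalize a21Of K r = a at ha
  obtain ⟨b, rfl⟩ : ∃ b, a = -b := ⟨-a, by ring⟩
  have hb : 0 ≤ b := by linarith
  have : qPoly K r (-b) = 10 * r ^ 2 * b ^ 4 + (100 * K ^ 2 + 10 * r ^ 2) * b ^ 3
    + (130 * K ^ 2 + 3 * r ^ 2) * b ^ 2 + 50 * K ^ 2 * b + 6 * K ^ 2 := by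
    rw [qPoly]; ring
  rw [this]
  positivity

lemma exists_root_of_neg (hK : 0 < K) (hr : 0 < r) (h : qPoly K r (a21Of K r) < 0) :
    ∃ r' > r, qPoly K r' (a21Of K r') = 0 := by
  have h10 : r < 10 := by
    by_contra! hle
    exact absurd h (not_lt.2 (qPoly_pos_of_ten_le hK hle).le)
  obtain ⟨r', hr', hz⟩ := intermediate_value_Ioo h10.le
    ((continuousOn_qPoly K).mono fun x hx => hr.trans_le hx.1)
    ⟨h, qPoly_pos_of_ten_le hK le_rfl⟩
  exact ⟨r', hr'.1, hz⟩

/-- The equation `a₂₁(K, r) = 81/100`, cleared of denominators, has a solution beyond every point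
at which `a₂₁ ≥ 81/100`. -/
lemma exists_root_gt (hK : 0 < K) {r₀ : ℝ} (hr₀ : 0 ≤ r₀)
    (h : r₀ * (1 - r₀ ^ 2 / K ^ 2 / 6 + (r₀ ^ 2 / K ^ 2) ^ 2 / 120) ≤ 1 - r₀ ^ 2 / K ^ 2 / 2
      + (r₀ ^ 2 / K ^ 2) ^ 2 / 24 - (r₀ ^ 2 / K ^ 2) ^ 3 * (81 / 100) / 240) :
    ∃ r' > r₀, qPoly K r' (a21Of K r') = 0 := by
  let ψ : ℝ → ℝ := fun r => 1 - r ^ 2 / K ^ 2 / 2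
      + (r ^ 2 / K ^ 2) ^ 2 / 24 - (r ^ 2 / K ^ 2) ^ 3 * (81 / 100) / 240
      - r * (1 - r ^ 2 / K ^ 2 / 6 + (r ^ 2 / K ^ 2) ^ 2 / 120)
  have hψ : Continuous ψ := by fun_prop
  -- At this radius k = 49/20, where the numerator with a = 81/100 is already negative.
  set R := K * √(49 / 20) with hR
  have hR0 : 0 < R := by positivity
  have hRk : R ^ 2 / K ^ 2 = 49 / 20 := by
    rw [hR, mul_pow, Real.sq_sqrt (by norm_num)]
    field_simp
  have hψR : ψ R < 0 := by
    have := mul_pos hR0 (denominator_pos (49 / 20))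
    simp only [ψ, hRk]
    norm_num at this ⊢
    linarith
  have hlt : r₀ < R := by
    rcases hr₀.eq_or_lt with rfl | hr₀
    · exact hR0
    have hk : r₀ ^ 2 / K ^ 2 < 49 / 20 :=
      lt_of_numerator_pos (a := 81 / 100) (by norm_num)
        ((mul_pos hr₀ (denominator_pos _)).trans_le h) (by positivity)
    rw [← hRk] at hk
    exact lt_of_pow_lt_pow_left₀ 2 hR0.le ((div_lt_div_iff_of_pos_right (by positivity)).1 hk)
  obtain ⟨r₁, hr₁, hz⟩ := intermediate_value_Icc' hlt.le hψ.continuousOn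
    ⟨hψR.le, sub_nonneg.2 h⟩
  have hr₁0 : 0 < r₁ := by
    refine (hr₀.trans hr₁.1).lt_of_ne ?_
    rintro rfl
    norm_num [ψ] at hz
  have heq : r₁ * (1 - r₁ ^ 2 / K ^ 2 / 6 + (r₁ ^ 2 / K ^ 2) ^ 2 / 120) = 1 - r₁ ^ 2 / K ^ 2 / 2
      + (r₁ ^ 2 / K ^ 2) ^ 2 / 24 - (r₁ ^ 2 / K ^ 2) ^ 3 * (81 / 100) / 240 :=
    (sub_eq_zero.1 hz).symm
  have ha : 81 / 100 = a21Of K r₁ := (eq_a21Of_iff hK hr₁0).2 heq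
  have hk : r₁ ^ 2 / K ^ 2 < 49 / 20 := by
    refine lt_of_numerator_pos (a := 81 / 100) (by norm_num) ?_ (by positivity)
    rw [← heq]
    exact mul_pos hr₁0 (denominator_pos _)
  -- The value 81/100 is chosen so that the k-term stays below the cubic for all k < 49/20; the
  -- margin is narrow.
  have hneg : qPoly K r₁ (a21Of K r₁) < 0 := by
    rw [← ha, qPoly_eq hK]
    refine mul_neg_of_pos_of_neg (by positivity) ?_
    norm_num
    linarith
  obtain ⟨r', hr', hz'⟩ := exists_root_of_neg hK hr₁0 hneg
  exact ⟨r', hr₁.1.trans_lt hr', hz'⟩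

lemma exists_isLargestRoot (hK : 0 < K) : ∃ C, IsLargestRoot K C := by
  -- Clearing denominators allows the starting point 0, where the inequality reads 0 ≤ 1.
  obtain ⟨r₀, hr₀, hz⟩ := exists_root_gt hK le_rfl (by norm_num)
  have hr₀' : r₀ ≤ 10 := by
    by_contra! hlt
    exact (qPoly_pos_of_ten_le hK hlt.le).ne' hz
  have hclosed : IsCompact (Icc r₀ 10 ∩ (fun r => qPoly K r (a21Of K r)) ⁻¹' {0}) := by
    refine isCompact_Icc.of_isClosed_subset ?_ inter_subset_left
    exact ((continuousOn_qPoly K).mono fun x hx => hr₀.trans_le hx.1).preimage_isClosed_of_isClosed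
      isClosed_Icc isClosed_singleton
  obtain ⟨C, hC, hmax⟩ := hclosed.exists_isGreatest ⟨r₀, ⟨le_rfl, hr₀'⟩, hz⟩
  refine ⟨C, ⟨hr₀.trans_le hC.1.1, hC.2⟩, fun r hr => ?_⟩
  rcases lt_or_ge r r₀ with h | h
  · exact h.le.trans hC.1.1
  · refine hmax ⟨⟨h, ?_⟩, hr.2⟩
    by_contra! hlt
    exact (qPoly_pos_of_ten_le hK hlt.le).ne' hr.2

lemma IsLargestRoot.qPoly_pos (hK : 0 < K) {C : ℝ} (hC : IsLargestRoot K C) (hr : C < r) :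
    0 < qPoly K r (a21Of K r) := by
  have hr0 : 0 < r := hC.1.1.trans hr
  by_contra! hle
  rcases hle.lt_or_eq with h | h
  · obtain ⟨r', hr', hz⟩ := exists_root_of_neg hK hr0 h
    exact absurd (hC.2 ⟨hr0.trans hr', hz⟩) (not_le.2 (hr.trans hr'))
  · exact absurd (hC.2 ⟨hr0, h⟩) (not_le.2 hr)

/-- A value of at least 81/100 would give, by `exists_root_gt`, a root beyond `C`. -/
lemma IsLargestRoot.a21Of_lt (hK : 0 < K) {C : ℝ} (hC : IsLargestRoot K C) :
    a21Of K C < 81 / 100 := by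
  by_contra! hle
  have h := (eq_a21Of_iff (a := a21Of K C) hK hC.1.1).1 rfl
  obtain ⟨r', hr', hz⟩ := exists_root_gt hK hC.1.1.le (by rw [h]; gcongr)
  exact absurd (hC.2 ⟨hC.1.1.trans hr', hz⟩) (not_le.2 hr')

lemma IsLargestRoot.range (hK : 0 < K) {C : ℝ} (hC : IsLargestRoot K C) :
    (27 / 100 < a21Of K C ∧ a21Of K C < 3 / 10 ∧ C ^ 2 / K ^ 2 < 1 / 2) ∨
      (18 / 25 < a21Of K C ∧ C ^ 2 / K ^ 2 < 49 / 20) := by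
  have hC0 := hC.1.1
  have hq := hC.1.2
  rw [qPoly_eq hK, mul_eq_zero, or_iff_right (by positivity), sub_eq_zero] at hq
  exact range_of_root (by positivity) hC0 (hC.a21Of_lt hK) ((eq_a21Of_iff hK hC0).1 rfl) hq

lemma IsLargestRoot.admissible (hK : 0 < K) {C : ℝ} (hC : IsLargestRoot K C) :
    Admissible (a21Of K C) := by
  rcases hC.range hK with ⟨h1, h2, -⟩ | ⟨h1, -⟩ <;>
    refine ⟨?_, ?_, ?_⟩ <;> intro h <;> linarith

lemma IsLargestRoot.SSPConditions (hK : 0 < K) {C : ℝ} (hC : IsLargestRoot K C) :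
    (family (a21Of K C)).SSPConditions K C :=
  family_SSPConditions_of_root hK hC.1.1 (hC.admissible hK) (hC.a21Of_lt hK) rfl hC.1.2

/-- For fixed a ≠ 0, `qPoly` is strictly increasing in r > 0 and vanishes at `C`, so any larger r
violates the necessary condition `qPoly` ≤ 0. -/
lemma IsLargestRoot.isSSPCoefficient (hK : 0 < K) {C : ℝ} (hC : IsLargestRoot K C) :
    (family (a21Of K C)).IsSSPCoefficient K C := by
  refine ⟨⟨hC.1.1, hC.SSPConditions hK⟩, fun r hr => ?_⟩
  by_contra! hlt
  have h := qPoly_nonpos_of_SSPConditions hK hr.1 (hC.admissible hK) hr.2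
  have h0 := hC.1.2
  have ha := (hC.admissible hK).1
  generalize a21Of K C = a at *
  have : qPoly K r a - qPoly K C a = (r ^ 2 - C ^ 2) * (a ^ 2 * (10 * a ^ 2 - 10 * a + 3)) := by
    rw [qPoly, qPoly]; ring
  have h1 : 0 < r ^ 2 - C ^ 2 := by nlinarith [hC.1.1]
  have h2 : 0 < 10 * a ^ 2 - 10 * a + 3 := by nlinarith [sq_nonneg (2 * a - 1)]
  have h3 : 0 < (r ^ 2 - C ^ 2) * (a ^ 2 * (10 * a ^ 2 - 10 * a + 3)) := by positivity
  linarith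

/-- Here a varies with r: the vanishing last entry forces a = `a21Of K r`, and along this curve
`qPoly` is positive past `C`. -/
lemma IsLargestRoot.isGreatest (hK : 0 < K) {C : ℝ} (hC : IsLargestRoot K C) :
    IsGreatest {r : ℝ | 0 < r ∧ ∃ a : ℝ, Admissible a ∧
      (family a).Re K r (Sum.inr ()) = 0 ∧ (family a).SSPConditions K r} C := by
  have hadm := hC.admissible hK
  refine ⟨⟨hC.1.1, a21Of K C, hadm, (family_Re_last_eq_zero_iff hK hC.1.1 hadm).2 rfl,
    hC.SSPConditions hK⟩, ?_⟩
  rintro r ⟨hr, a, ha, hRe, hS⟩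
  by_contra! hlt
  rw [family_Re_last_eq_zero_iff hK hr ha] at hRe
  have h := qPoly_nonpos_of_SSPConditions hK hr ha hS
  rw [hRe] at h
  exact absurd (hC.qPoly_pos hK hlt) (not_lt.2 h)

lemma IsLargestRoot.abs_sub_lt {C : ℝ} (hC : IsLargestRoot (1 / √2) C) :
    |C - 0.6747| < 0.00005 := by
  have hK : (0 : ℝ) < 1 / √2 := by positivity
  have hK2 : (1 / √2 : ℝ) ^ 2 = 1 / 2 := by rw [div_pow, Real.sq_sqrt (by norm_num)]; norm_num
  have hC0 : 0 < C := hC.1.1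
  have hlow : 0.67465 < C := by
    -- A negative value at 0.67465 forces a root further right, hence a lower bound for the largest
    -- one.
    have hneg : qPoly (1 / √2) 0.67465 (a21Of (1 / √2) 0.67465) < 0 := by
      have ha : a21Of (1 / √2) 0.67465 = 1 / 8 / 0.67465 ^ 6 * (-(2 * 4) * 0.67465 ^ 5
          + 10 * 4 * 0.67465 ^ 4 + 40 * 2 * 0.67465 ^ 3 - 120 * 2 * 0.67465 ^ 2 - 240 * 0.67465
          + 240) := by
        rw [a21Of, show (1 / √2 : ℝ) ^ 6 = ((1 / √2) ^ 2) ^ 3 by ring,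
          show (1 / √2 : ℝ) ^ 4 = ((1 / √2) ^ 2) ^ 2 by ring, hK2]
        norm_num
      rw [ha, qPoly, hK2]
      norm_num
    obtain ⟨r', hr', hz⟩ := exists_root_of_neg hK (by norm_num) hneg
    exact hr'.trans_le (hC.2 ⟨by linarith, hz⟩)
  have hhigh : C < 0.67475 := by
    have h := (eq_a21Of_iff (a := a21Of (1 / √2) C) hK hC0).1 rfl
    have hk : C ^ 2 / (1 / √2) ^ 2 = 2 * C ^ 2 := by rw [hK2]; ring
    have hrange := hC.range hK
    rw [hk] at h hrange
    rcases hrange with ⟨-, -, h2⟩ | ⟨h1, h2⟩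
    · nlinarith
    · have hC1 := le_one_of_eq (by positivity) (by linarith) (by linarith) h
      by_contra! hle
      -- The bound a > 18/25 alone makes the right side of the relation too small once C ≥ 0.67475,
      -- so no evaluation of `qPoly` is needed.
      have h3 : (2 * C ^ 2) ^ 3 * (18 / 25) ≤ (2 * C ^ 2) ^ 3 * a21Of (1 / √2) C := by gcongr
      obtain ⟨t, rfl⟩ : ∃ t, C = 0.67475 + t := ⟨C - 0.67475, by ring⟩
      have ht : 0 ≤ t := by linarith
      have ht1 : t ≤ 1 / 3 := by linarith
      generalize a21Of (1 / √2) (0.67475 + t) = a at *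
      norm_num at *
      nlinarith [pow_nonneg ht 2, pow_nonneg ht 3, pow_nonneg ht 4, pow_nonneg ht 5, pow_nonneg ht 6]
  rw [abs_lt]
  constructor <;> linarith

end FifthOrder

theorem mainTheorem3 :
    -- within the simplified form, order five means membership in the one-parameter family
    (∀ a21 a31 ah21 ah31 ah32 bh1 bh2 bh3 : ℝ,
      ((simplifiedMethod a21 a31 ah21 ah31 ah32 bh1 bh2 bh3).HasOrder 5 ↔
        FifthOrder.Admissible a21 ∧ ah21 = FifthOrder.ah21 a21 ∧ a31 = FifthOrder.a31 a21 ∧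
          ah32 = FifthOrder.ah32 a21 ∧ ah31 = FifthOrder.ah31 a21 ∧
          bh2 = FifthOrder.bh2 a21 ∧ bh3 = FifthOrder.bh3 a21 ∧ bh1 = FifthOrder.bh1 a21) ∧
      ((simplifiedMethod a21 a31 ah21 ah31 ah32 bh1 bh2 bh3).HasOrder 5 ↔
        (simplifiedMethod a21 a31 ah21 ah31 ah32 bh1 bh2 bh3).OrderConditionsFive)) ∧
    -- the two conditions that determine `a₂₁` and `r`
    (∀ K r a : ℝ, 0 < K → 0 < r → FifthOrder.Admissible a →
      ((FifthOrder.family a).Re K r (Sum.inr ()) = 0 ↔ a = FifthOrder.a21Of K r) ∧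
      ((FifthOrder.family a).Q K r (Sum.inl 2) (Sum.inl 0) = 0 ↔ FifthOrder.qPoly K r a = 0)) ∧
    -- for every `K > 0` the resulting method has order five and positive SSP coefficient
    (∀ K : ℝ, 0 < K → ∃ C : ℝ, 0 < C ∧ FifthOrder.IsLargestRoot K C ∧
      FifthOrder.Admissible (FifthOrder.a21Of K C) ∧
      (FifthOrder.family (FifthOrder.a21Of K C)).HasOrder 5 ∧
      (FifthOrder.family (FifthOrder.a21Of K C)).Re K C (Sum.inr ()) = 0 ∧
      (FifthOrder.family (FifthOrder.a21Of K C)).Q K C (Sum.inl 2) (Sum.inl 0) = 0 ∧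
      (FifthOrder.family (FifthOrder.a21Of K C)).IsSSPCoefficient K C ∧
      (FifthOrder.family (FifthOrder.a21Of K C)).PreservesStrongStability.{v} K C ∧
      -- `C` is the largest `r` at which some method of the family with `(R e)_last = 0` is SSP
      IsGreatest {r : ℝ | 0 < r ∧ ∃ a : ℝ, FifthOrder.Admissible a ∧
        (FifthOrder.family a).Re K r (Sum.inr ()) = 0 ∧
        (FifthOrder.family a).SSPConditions K r} C) ∧
    -- the value for `K = 1/√2`, to four decimals
    (∀ C : ℝ, FifthOrder.IsLargestRoot (1 / √2) C → |C - 0.6747| < 0.00005) ∧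
    -- the order barrier for explicit SSP Runge--Kutta methods
    (∀ (s : ℕ) (M : TwoDerivMethod s), M.IsRungeKutta →
      ∀ K r : ℝ, 0 < K → 0 < r → M.SSPConditions K r → ∀ p : ℕ, M.HasOrder p → p ≤ 4) := by
  refine ⟨fun a21 a31 ah21 ah31 ah32 bh1 bh2 bh3 => ⟨?_, ?_⟩, fun K r a hK hr ha => ⟨?_, ?_⟩,
    fun K hK => ?_, fun C hC => hC.abs_sub_lt, fun s M hM K r _ hr hMr p hp => ?_⟩
  · rw [hasOrder_five_iff_reduced, reducedOrderConditions_iff]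
  · rw [hasOrder_five_iff_reduced, orderConditionsFive_iff_reduced]
  · exact FifthOrder.family_Re_last_eq_zero_iff hK hr ha
  · exact FifthOrder.family_Q_eq_zero_iff hK hr ha
  · obtain ⟨C, hC⟩ := FifthOrder.exists_isLargestRoot hK
    have hadm := hC.admissible hK
    exact ⟨C, hC.1.1, hC, hadm, hasOrder_five_iff_reduced.2 hadm.reducedOrderConditions,
      (FifthOrder.family_Re_last_eq_zero_iff hK hC.1.1 hadm).2 rfl,
      (FifthOrder.family_Q_eq_zero_iff hK hC.1.1 hadm).2 hC.1.2, hC.isSSPCoefficient hK,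
      (hC.SSPConditions hK).preservesStrongStability hK hC.1.1, hC.isGreatest hK⟩
  · exact hM.order_le_four hr hMr hp
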